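/- Let $\Sigma$ be a finite simplicial complex and $d\ge 0$. Write $\Sigma_d$ for the set of its $d$-simplices (faces with $d+1$ vertices) and $n=\#\Sigma_d$. Fix an arbitrary orientation $[\sigma]$ of every simplex $\sigma$, and let $\operatorname{sgn}([\tau],\partial[\rho])\in\{-1,0,1\}$ be the coefficient of $[\tau]$ in $\partial[\rho]$ for $\tau\in\Sigma_d$, $\rho\in\Sigma_{d+1}$. Let $\deg\tau=\#\{\rho\in\Sigma_{d+1}:\tau\subset\rho\}$ and let $n_+$ be the number of $\tau\in\Sigma_d$ with $\deg\tau>0$ (so $n_+=n$ if all degrees are positive). Let $\Delta_d^{up}=\delta_d^*\delta_d$ be the normalized up-Laplacian on $C^d(\Sigma)\cong\mathbb{R}^{\Sigma_d}$, that is, $$(\Delta_d^{up}f)([\tau])=\frac1{\deg\tau}\sum_{\rho\in\Sigma_{d+1},\,\rho\supset\tau}\operatorname{sgn}([\tau],\partial[\rho])\sum_{\tau'\in\Sigma_d,\,\tau'\subset\rho}\operatorname{sgn}([\tau'],\partial[\rho])f([\tau']),$$ read as $0$ when $\deg\tau=0$. It has $n$ real eigenvalues counted with multiplicity, $\lambda_1(\Delta_d^{up})\le\dots\le\lambda_n(\Delta_d^{up})$.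 Let $\Gamma_d$ be the graph on $\Sigma_d$ in which two different $\tau,\tau'$ are adjacent if they are facets of a common $\rho\in\Sigma_{d+1}$ (which is then unique), with edge sign $s(\tau,\tau')=\operatorname{sgn}([\tau],\partial[\rho])\operatorname{sgn}([\tau'],\partial[\rho])$. For disjoint $A,A'\subset\Sigma_d$ let $E^-(A)$ be the set of edges of sign $-1$ with both ends in $A$, let $E^+(A,A')$ be the set of edges of sign $+1$ with one end in $A$ and the other in $A'$, let $|\partial A|$ be the number of edges between $A$ and $\Sigma_d\setminus A$, let $\operatorname{vol}(A)=\sum_{\tau\in A}\deg\tau$, and, if $\operatorname{vol}(A\sqcup A')>0$, let $$\beta(A,A')=\frac{2\left(|E^-(A)|+|E^-(A')|+|E^+(A,A')|\right)+|\partial(A\sqcup A')|}{\operatorname{vol}(A\sqcup A')}.$$ For $1\le k\le n_+$ let $$h_k(\Sigma_d)=\min_{A_1,\dots,A_{2k}}\ \max_{1\le i\le k}\beta(A_{2i-1},A_{2i}),$$ the minimum being over all pairwise disjoint $A_1,\dots,A_{2k}\subset\Sigma_d$ with $\operatorname{vol}(A_{2i-1}\sqcup A_{2i})>0$ for all $i$.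 **Theorem.** If $n_+\ge1$, then $$\frac{h_1(\Sigma_d)^2}{2(d+1)}\le d+2-\lambda_n(\Delta_d^{up})\le 2h_1(\Sigma_d).$$ Moreover, there is an absolute constant $C>0$ such that for every finite simplicial complex $\Sigma$, every $d\ge0$ and every $k$ with $1\le k\le n_+$, $$\frac{h_k(\Sigma_d)^2}{Ck^6(d+1)}\le d+2-\lambda_{n+1-k}(\Delta_d^{up})\le 2h_k(\Sigma_d).$$ -/

import Mathlib

namespace SimplicialCheeger

variable {V : Type*}

/-- The set `Σ_d` of `d`-simplices (faces with `d + 1` vertices) of a simplicial complex. -/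
def Simplex (K : PreAbstractSimplicialComplex V) (d : ℕ) : Type _ :=
  {σ : Finset V // σ ∈ K.faces ∧ σ.card = d + 1}

noncomputable instance [Finite V] (K : PreAbstractSimplicialComplex V) (d : ℕ) :
    Fintype (Simplex K d) :=
  @Fintype.ofFinite _ (inferInstanceAs
    (Finite {σ : Finset V // σ ∈ K.faces ∧ σ.card = d + 1}))

noncomputable instance (K : PreAbstractSimplicialComplex V) (d : ℕ) :
    DecidableEq (Simplex K d) := Classical.decEq _

/-- A choice of orientation of every simplex of `K`: an orientation is represented by an ordering
`[v_0, …, v_d]` of the vertices (two orderings that differ by an even permutation are the same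
orientation). The ordering chosen for different simplices need not be compatible. -/
def SimplexOrientation (K : PreAbstractSimplicialComplex V) : Type _ :=
  ∀ (d : ℕ) (σ : Simplex K d), Fin (d + 1) ≃ {v : V // v ∈ σ.1}

variable {K : PreAbstractSimplicialComplex V}

open Classical in
/-- `sgn([τ], ∂[ρ])`: the coefficient of `[τ]` in
`∂[v_0, …, v_{d+1}] = ∑_j (-1)^j [v_0, …, v_{j-1}, v_{j+1}, …, v_{d+1}]`,
where `[ρ] = [v_0, …, v_{d+1}]`. The ordered simplex `[v_0, …, v_{j-1}, v_{j+1}, …, v_{d+1}]` is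
`sign π • [τ]` if it arises from the ordering of `τ` by the permutation `π`. At most one pair
`(j, π)` contributes, and none does if `τ` is not a facet of `ρ`. -/
noncomputable def sgn (o : SimplexOrientation K) {d : ℕ}
    (τ : Simplex K d) (ρ : Simplex K (d + 1)) : ℤ :=
  ∑ j : Fin (d + 2), ∑ π : Equiv.Perm (Fin (d + 1)),
    if ∀ i, ((o (d + 1) ρ (j.succAbove i) : {v : V // v ∈ ρ.1}) : V) = (o d τ (π i) : V) then
      (-1) ^ (j : ℕ) * ((Equiv.Perm.sign π : ℤˣ) : ℤ)
    else 0

/-- `deg τ`, the number of `(d+1)`-simplices containing the `d`-simplex `τ`. -/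
noncomputable def deg {d : ℕ} (τ : Simplex K d) : ℕ :=
  {ρ : Simplex K (d + 1) | τ.1 ⊆ ρ.1}.ncard

theorem subset_of_sgn_ne_zero (o : SimplexOrientation K) {d : ℕ} (τ : Simplex K d)
    (ρ : Simplex K (d + 1)) (h : sgn o τ ρ ≠ 0) : τ.1 ⊆ ρ.1 := by
  classical
  by_contra hs
  refine h (Finset.sum_eq_zero fun j _ => Finset.sum_eq_zero fun π _ => if_neg fun hj => hs ?_)
  intro v hv
  have h1 := hj (π.symm ((o d τ).symm ⟨v, hv⟩))
  simp only [Equiv.apply_symm_apply] at h1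
  exact h1 ▸ (o (d + 1) ρ _).2

section Laplacian

variable [Finite V]

/-- The coboundary `δ_d : C^d → C^{d+1}`, cochains being written in the bases given by the chosen
orientations: `(δf)([ρ]) = ∑_τ sgn([τ], ∂[ρ]) f([τ])`. -/
noncomputable def coboundary (o : SimplexOrientation K) (d : ℕ) :
    Matrix (Simplex K (d + 1)) (Simplex K d) ℝ :=
  Matrix.of fun ρ τ => (sgn o τ ρ : ℝ)

/-- The adjoint `δ_d^* : C^{d+1} → C^d` of the coboundary for the scalar products
`∑_τ deg τ f(τ) g(τ)` on `C^d` and `∑_ρ f(ρ) g(ρ)` on `C^{d+1}` (see `inner_coboundary`).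
A row that belongs to a simplex of degree `0` is `0`. -/
noncomputable def coboundaryAdjoint (o : SimplexOrientation K) (d : ℕ) :
    Matrix (Simplex K d) (Simplex K (d + 1)) ℝ :=
  Matrix.of fun τ ρ => (deg τ : ℝ)⁻¹ * (sgn o τ ρ : ℝ)

/-- The normalized up-Laplacian `Δ_d^{up} = δ_d^* δ_d`. -/
noncomputable def upLaplacian (o : SimplexOrientation K) (d : ℕ) :
    Matrix (Simplex K d) (Simplex K d) ℝ :=
  coboundaryAdjoint o d * coboundary o d

/-- `λ_i(Δ_d^{up})`, for `1 ≤ i ≤ #Σ_d`: the `i`-th smallest eigenvalue, counted with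
multiplicity. (By `card_roots_upLaplacian` there are exactly `#Σ_d` real eigenvalues.) -/
noncomputable def eigenvalue (o : SimplexOrientation K) (d i : ℕ) : ℝ :=
  ((upLaplacian o d).charpoly.roots.sort (· ≤ ·)).getD (i - 1) 0

theorem deg_pos_of_sgn_ne_zero (o : SimplexOrientation K) {d : ℕ} (τ : Simplex K d)
    (ρ : Simplex K (d + 1)) (h : sgn o τ ρ ≠ 0) : 0 < deg τ :=
  (Set.ncard_pos (Set.toFinite _)).2 ⟨ρ, subset_of_sgn_ne_zero o τ ρ h⟩

theorem inner_coboundary (o : SimplexOrientation K) (d : ℕ) (f : Simplex K d → ℝ)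
    (g : Simplex K (d + 1) → ℝ) :
    ∑ ρ, (coboundary o d).mulVec f ρ * g ρ =
      ∑ τ, (deg τ : ℝ) * (f τ * (coboundaryAdjoint o d).mulVec g τ) := by
  simp only [Matrix.mulVec, dotProduct, coboundary, coboundaryAdjoint, Matrix.of_apply,
    Finset.sum_mul, Finset.mul_sum]
  rw [Finset.sum_comm]
  refine Finset.sum_congr rfl fun τ _ => Finset.sum_congr rfl fun ρ _ => ?_
  by_cases h : sgn o τ ρ = 0
  · simp [h]
  · have : (deg τ : ℝ) ≠ 0 := by exact_mod_cast (deg_pos_of_sgn_ne_zero o τ ρ h).ne'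
    field_simp

theorem card_roots_upLaplacian (o : SimplexOrientation K) (d : ℕ) :
    (upLaplacian o d).charpoly.roots.card = Fintype.card (Simplex K d) := by
  set W : Matrix (Simplex K d) (Simplex K d) ℝ :=
    Matrix.diagonal fun τ => Real.sqrt ((deg τ : ℝ)⁻¹) with hW
  have h1 : upLaplacian o d = W * (W * ((coboundary o d).transpose * coboundary o d)) := by
    rw [upLaplacian, ← Matrix.mul_assoc, ← Matrix.mul_assoc]
    congr 1
    ext τ ρ
    rw [hW, Matrix.diagonal_mul_diagonal, Matrix.diagonal_mul]
    simp only [coboundary, coboundaryAdjoint, Matrix.of_apply]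
    rw [Real.mul_self_sqrt (by positivity)]
    rfl
  have h2 : (W * ((coboundary o d).transpose * coboundary o d) * W).IsHermitian := by
    have hWt : W.transpose = W := Matrix.diagonal_transpose _
    rw [Matrix.IsHermitian, Matrix.conjTranspose_eq_transpose_of_trivial]
    simp only [Matrix.transpose_mul, hWt, Matrix.transpose_transpose, Matrix.mul_assoc]
  rw [h1, Matrix.charpoly_mul_comm, h2.roots_charpoly_eq_eigenvalues]
  simp

end Laplacian

/-- The graph `Γ_d` on `Σ_d`: two different `d`-simplices are adjacent if they are facets of a
common `(d+1)`-simplex. -/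
def upGraph (K : PreAbstractSimplicialComplex V) (d : ℕ) : SimpleGraph (Simplex K d) where
  Adj τ τ' := τ ≠ τ' ∧ ∃ ρ : Simplex K (d + 1), τ.1 ⊆ ρ.1 ∧ τ'.1 ⊆ ρ.1
  symm := ⟨fun _ _ h => ⟨h.1.symm, h.2.imp fun _ hρ => hρ.symm⟩⟩
  loopless := ⟨fun _ h => h.1 rfl⟩

section Cheeger

variable [Finite V]

/-- The sign `s([τ],[τ']) = sgn([τ], ∂[ρ]) sgn([τ'], ∂[ρ])` of an edge of `Γ_d`, with `ρ` the unique
`(d+1)`-simplex that has `τ` and `τ'` as facets. (All other terms of the sum are `0`.) -/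
noncomputable def edgeSign (o : SimplexOrientation K) {d : ℕ} (τ τ' : Simplex K d) : ℤ :=
  ∑ ρ : Simplex K (d + 1), sgn o τ ρ * sgn o τ' ρ

/-- The number of (unordered) edges of `Γ_d` of sign `c` with one end in `A` and the other in `B`.
So `|E⁻(A)| = signedEdges o (-1) A A` and `|E⁺(A, A')| = signedEdges o 1 A A'`. -/
noncomputable def signedEdges (o : SimplexOrientation K) {d : ℕ} (c : ℤ)
    (A B : Finset (Simplex K d)) : ℕ :=
  {e : Sym2 (Simplex K d) | ∃ τ ∈ A, ∃ τ' ∈ B,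
    e = s(τ, τ') ∧ (upGraph K d).Adj τ τ' ∧ edgeSign o τ τ' = c}.ncard

/-- `|∂A|`, the number of edges of `Γ_d` between `A` and its complement. -/
noncomputable def boundarySize {d : ℕ} (A : Finset (Simplex K d)) : ℕ :=
  {e : Sym2 (Simplex K d) | ∃ τ ∈ A, ∃ τ' ∉ A, e = s(τ, τ') ∧ (upGraph K d).Adj τ τ'}.ncard

/-- `vol(A) = ∑_{τ ∈ A} deg τ`. -/
noncomputable def vol {d : ℕ} (A : Finset (Simplex K d)) : ℕ := ∑ τ ∈ A, deg τ

/-- The signed bipartiteness ratio `β(A, A')`. -/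
noncomputable def beta (o : SimplexOrientation K) {d : ℕ} (A A' : Finset (Simplex K d)) : ℝ :=
  (2 * ((signedEdges o (-1) A A : ℝ) + signedEdges o (-1) A' A' + signedEdges o 1 A A')
    + boundarySize (A ∪ A')) / vol (A ∪ A')

/-- A family of `2k` pairwise disjoint sets of `d`-simplices, grouped into `k` pairs
`(A (i, 0), A (i, 1))`, such that `β` is defined for each pair, that is, each pair has positive
volume. If all degrees are positive this says that no pair is `(∅, ∅)`. -/
def IsAdmissible {d k : ℕ} (A : Fin k × Fin 2 → Finset (Simplex K d)) : Prop :=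
  Pairwise (fun p q => Disjoint (A p) (A q)) ∧ ∀ i, 0 < vol (A (i, 0) ∪ A (i, 1))

/-- The `k`-th Cheeger constant `h_k(Σ_d)`. -/
noncomputable def cheeger (o : SimplexOrientation K) (d k : ℕ) : ℝ :=
  ⨅ A : {A : Fin k × Fin 2 → Finset (Simplex K d) // IsAdmissible A},
    ⨆ i : Fin k, beta o (A.1 (i, 0)) (A.1 (i, 1))

end Cheeger

end SimplicialCheeger

/-!
Every `d`-simplex `τ` has `(d + 1) deg τ` neighbours in `Γ_d`, so `d + 2 - Δ_d^up` is the Laplacian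
of the signed graph `Γ_d` with respect to the weights `deg τ`: its quadratic form is the energy
`½ ∑ (f τ - s(τ, τ') f τ')²`, and the theorem compares the smallest values of the Rayleigh
quotient with the signed Cheeger constants.

Upper bound: the `k` disjointly supported functions `1_A - 1_{A'}` attached to an admissible family
span a space on which the Rayleigh quotient is at most `2 max β`, and Courant–Fischer applies.

Lower bound: if `β ≥ h` for all the pairs `{f² > t, f > 0}`, `{f² > t, f < 0}` of level sets of a
function `f`, then integrating over `t` (the coarea formula) and the Cauchy–Schwarz inequality show
that `h² ≤ 2 (d + 1) R`, where `R` is the Rayleigh quotient of `f`. So it remains to find `k`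
disjointly supported functions of small Rayleigh quotient. Let `F τ = (f₁ τ, …, f_k τ)` collect the
eigenfunctions of the `k` largest eigenvalues of `Δ_d^up`. As these are orthonormal, the masses
`deg τ ‖F τ‖²`, of total `k`, are in isotropic position, so no small ball of the projective space of
directions (`v` and `-v` are identified, because `F` may jump to `-F` across a negative edge at no
cost) carries much of the mass. Carving random balls out of this space produces `k` separated pieces
of mass at least `1/2`, and cutting `F` off to these pieces by Lipschitz functions costs a factor of
order `k⁶`.
-/

namespace SimplicialCheeger

section LevelSets

open MeasureTheory

/-- The truncation `sign a · 1_{t < a²}` of a real number `a` at the level `t`. Applied to the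
values of a function `f` it gives the difference of the indicator functions of the level sets
`{f > √t}` and `{f < -√t}`. -/
noncomputable def levelSign (t a : ℝ) : ℝ := if t < a ^ 2 then SignType.sign a else 0

theorem levelSign_signType_mul (t : ℝ) (s : SignType) (a : ℝ) :
    levelSign t (s * a) = s * levelSign t a := by
  cases s <;> simp [levelSign, Left.sign_neg]

theorem abs_levelSign (t a : ℝ) : |levelSign t a| = levelSign t |a| := by
  unfold levelSign
  rw [sq_abs]
  split_ifs
  · rcases lt_trichotomy a 0 with ha | rfl | ha <;> simp [*, ne_of_lt, ne_of_gt]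
  · exact abs_zero

theorem monotone_signType_cast : Monotone ((↑) : SignType → ℝ) := by
  intro s t h
  cases s <;> cases t <;> first | exact absurd h (by decide) | norm_num

theorem monotone_levelSign (t : ℝ) : Monotone (levelSign t) := by
  intro a b hab
  unfold levelSign
  split_ifs with ha hb hb
  · exact monotone_signType_cast (SignType.sign.monotone hab)
  · have : a ≤ 0 := by
      by_contra! h
      exact hb (ha.trans_le (pow_le_pow_left₀ h.le hab 2))
    simpa using monotone_signType_cast (SignType.sign.monotone this)
  · have : 0 ≤ b := by
      by_contra! h
      exact ha (hb.trans_le (by nlinarith))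
    simpa using monotone_signType_cast (SignType.sign.monotone this)
  · exact le_rfl

theorem levelSign_eq_indicator (a : ℝ) :
    (levelSign · a) = (Set.Iio (a ^ 2)).indicator fun _ => (SignType.sign a : ℝ) := by
  ext t
  simp only [levelSign, Set.indicator_apply, Set.mem_Iio]

theorem integrableOn_levelSign (a : ℝ) : IntegrableOn (levelSign · a) (Set.Ioi 0) := by
  rw [levelSign_eq_indicator, IntegrableOn, integrable_indicator_iff measurableSet_Iio,
    IntegrableOn, Measure.restrict_restrict measurableSet_Iio, Set.Iio_inter_Ioi]
  exact integrableOn_const measure_Ioo_lt_top.ne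

theorem integral_levelSign (a : ℝ) : ∫ t in Set.Ioi 0, levelSign t a = a * |a| := by
  rw [levelSign_eq_indicator, integral_indicator measurableSet_Iio,
    Measure.restrict_restrict measurableSet_Iio, Set.Iio_inter_Ioi, setIntegral_const,
    Real.volume_real_Ioo_of_le (sq_nonneg a), sub_zero, smul_eq_mul, sq, mul_assoc,
    self_mul_sign]

theorem integral_abs_levelSign (a : ℝ) : ∫ t in Set.Ioi 0, |levelSign t a| = a ^ 2 := by
  simp only [abs_levelSign, integral_levelSign, abs_abs, ← sq, sq_abs]

theorem integral_abs_levelSign_sub (a b : ℝ) :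
    ∫ t in Set.Ioi 0, |levelSign t a - levelSign t b| = |a * |a| - (b * |b|)| := by
  wlog hab : b ≤ a generalizing a b
  · simpa only [abs_sub_comm] using this b a (le_of_not_ge hab)
  have hmono : ∀ t, levelSign t b ≤ levelSign t a := fun t => monotone_levelSign t hab
  simp only [fun t => abs_of_nonneg (sub_nonneg.2 (hmono t))]
  rw [integral_sub (integrableOn_levelSign a) (integrableOn_levelSign b), integral_levelSign,
    integral_levelSign, abs_of_nonneg (sub_nonneg.2 _)]
  rw [← integral_levelSign, ← integral_levelSign]
  exact integral_mono (integrableOn_levelSign b) (integrableOn_levelSign a) hmono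

theorem abs_mul_abs_sub_mul_abs_le (a b : ℝ) :
    |a * |a| - (b * |b|)| ≤ |a - b| * (|a| + |b|) := by
  have hsplit : a * |a| - b * |b| = ((a - b) * (|a| + |b|) + (a + b) * (|a| - |b|)) / 2 := by ring
  have hsum : |(a + b) * (|a| - |b|)| ≤ |a - b| * (|a| + |b|) := by
    rw [abs_mul, mul_comm]
    exact mul_le_mul (abs_abs_sub_abs_le a b) (abs_add_le a b) (abs_nonneg _) (abs_nonneg _)
  have hdiff : |(a - b) * (|a| + |b|)| = |a - b| * (|a| + |b|) := by
    rw [abs_mul, abs_of_nonneg (a := |a| + |b|) (by positivity)]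
  rw [hsplit, abs_div, abs_two]
  linarith [abs_add_le ((a - b) * (|a| + |b|)) ((a + b) * (|a| - |b|))]

theorem integral_abs_levelSign_sub_mul_le (s : SignType) (hs : s ≠ 0) (a b : ℝ) :
    ∫ t in Set.Ioi 0, |levelSign t a - s * levelSign t b| ≤ |a - s * b| * (|a| + |b|) := by
  have habs : |(s : ℝ) * b| = |b| := by cases s <;> simp_all
  simp only [← levelSign_signType_mul, integral_abs_levelSign_sub]
  simpa only [habs] using abs_mul_abs_sub_mul_abs_le a (s * b)

end LevelSets

section SignedGraph

open MeasureTheory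

variable {X : Type*} [Fintype X]

/-- The Dirichlet energy `∑ (f x - σ(x, y) f y)²` of `f`, summed over the edges of the signed graph
with signed adjacency matrix `σ` (each edge occurs in two ordered pairs, hence the factor `1/2`). -/
noncomputable def signedEnergy (σ : X → X → SignType) (f : X → ℝ) : ℝ :=
  (∑ x, ∑ y, |(σ x y : ℝ)| * (f x - σ x y * f y) ^ 2) / 2

/-- The total variation `∑ |f x - σ(x, y) f y|` of `f`, summed over the edges of the signed graph
with signed adjacency matrix `σ`. -/
noncomputable def signedVariation (σ : X → X → SignType) (f : X → ℝ) : ℝ :=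
  (∑ x, ∑ y, |(σ x y : ℝ)| * |f x - σ x y * f y|) / 2

theorem signedEnergy_nonneg (σ : X → X → SignType) (f : X → ℝ) : 0 ≤ signedEnergy σ f := by
  unfold signedEnergy
  positivity

theorem sum_abs_mul_sq_add_sq {σ : X → X → SignType} (hsymm : ∀ x y, σ x y = σ y x)
    (f : X → ℝ) :
    ∑ x, ∑ y, |(σ x y : ℝ)| * (f x ^ 2 + f y ^ 2) = 2 * ∑ x, (∑ y, |(σ x y : ℝ)|) * f x ^ 2 := by
  have hright : ∑ x, ∑ y, |(σ x y : ℝ)| * f y ^ 2 = ∑ x, ∑ y, |(σ x y : ℝ)| * f x ^ 2 := by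
    rw [Finset.sum_comm]
    simp only [hsymm]
  simp only [mul_add, Finset.sum_add_distrib, hright, Finset.sum_mul]
  ring

theorem signedEnergy_eq_sub {σ : X → X → SignType} (hsymm : ∀ x y, σ x y = σ y x) (f : X → ℝ) :
    signedEnergy σ f =
      ∑ x, (∑ y, |(σ x y : ℝ)|) * f x ^ 2 - ∑ x, ∑ y, f x * (σ x y * f y) := by
  have hexpand : ∀ x y, |(σ x y : ℝ)| * (f x - σ x y * f y) ^ 2 =
      |(σ x y : ℝ)| * (f x ^ 2 + f y ^ 2) - 2 * (f x * (σ x y * f y)) := fun x y => by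
    cases σ x y <;> simp <;> ring
  simp only [signedEnergy, hexpand, Finset.sum_sub_distrib, ← Finset.mul_sum]
  rw [sum_abs_mul_sq_add_sq hsymm]
  ring

theorem sum_abs_mul_sq_add_sq_le {σ : X → X → SignType} (hsymm : ∀ x y, σ x y = σ y x)
    {m : X → ℝ} {D : ℝ} (hdeg : ∀ x, ∑ y, |(σ x y : ℝ)| ≤ D * m x) (f : X → ℝ) :
    ∑ x, ∑ y, |(σ x y : ℝ)| * (f x ^ 2 + f y ^ 2) ≤ 2 * D * ∑ x, m x * f x ^ 2 := by
  rw [sum_abs_mul_sq_add_sq hsymm, mul_assoc, Finset.mul_sum _ _ D]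
  refine mul_le_mul_of_nonneg_left (Finset.sum_le_sum fun x _ => ?_) zero_le_two
  rw [← mul_assoc]
  exact mul_le_mul_of_nonneg_right (hdeg x) (sq_nonneg _)

theorem integrableOn_abs_levelSign_sub_mul (s : SignType) (a b : ℝ) :
    IntegrableOn (fun t => |levelSign t a - s * levelSign t b|) (Set.Ioi 0) :=
  ((integrableOn_levelSign a).sub ((integrableOn_levelSign b).const_mul _)).abs

theorem integrableOn_signedVariation_levelSign (σ : X → X → SignType) (f : X → ℝ) :
    IntegrableOn (fun t => signedVariation σ fun x => levelSign t (f x)) (Set.Ioi 0) :=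
  (integrable_finsetSum _ fun x _ => integrable_finsetSum _ fun y _ =>
    (integrableOn_abs_levelSign_sub_mul (σ x y) (f x) (f y)).const_mul _).div_const _

theorem integral_signedVariation_levelSign_le (σ : X → X → SignType) (f : X → ℝ) :
    ∫ t in Set.Ioi 0, signedVariation σ (fun x => levelSign t (f x)) ≤
      (∑ x, ∑ y, |(σ x y : ℝ)| * (|f x - σ x y * f y| * (|f x| + |f y|))) / 2 := by
  have hint : ∀ x y, IntegrableOn (fun t => |(σ x y : ℝ)| *
      |levelSign t (f x) - σ x y * levelSign t (f y)|) (Set.Ioi 0) := fun x y =>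
    (integrableOn_abs_levelSign_sub_mul (σ x y) (f x) (f y)).const_mul _
  simp only [signedVariation]
  rw [integral_div, integral_finsetSum _ fun x _ => integrable_finsetSum _ fun y _ => hint x y]
  refine div_le_div_of_nonneg_right (Finset.sum_le_sum fun x _ => ?_) two_pos.le
  rw [integral_finsetSum _ fun y _ => hint x y]
  refine Finset.sum_le_sum fun y _ => ?_
  rw [integral_const_mul]
  by_cases hxy : σ x y = 0
  · simp [hxy]
  · exact mul_le_mul_of_nonneg_left (integral_abs_levelSign_sub_mul_le _ hxy _ _) (abs_nonneg _)

theorem integral_sum_mul_abs_levelSign (m f : X → ℝ) :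
    ∫ t in Set.Ioi 0, ∑ x, m x * |levelSign t (f x)| = ∑ x, m x * f x ^ 2 := by
  rw [integral_finsetSum _ fun x _ => (integrableOn_levelSign (f x)).abs.const_mul _]
  simp only [integral_const_mul, integral_abs_levelSign]

theorem sq_sum_abs_sub_mul_le {σ : X → X → SignType} (hsymm : ∀ x y, σ x y = σ y x)
    {m : X → ℝ} {D : ℝ} (hdeg : ∀ x, ∑ y, |(σ x y : ℝ)| ≤ D * m x) (f : X → ℝ) :
    (∑ x, ∑ y, |(σ x y : ℝ)| * (|f x - σ x y * f y| * (|f x| + |f y|))) ^ 2 ≤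
      2 * signedEnergy σ f * (4 * D * ∑ x, m x * f x ^ 2) := by
  have hcauchy := Finset.sum_sq_le_sum_mul_sum_of_sq_le_mul (Finset.univ : Finset (X × X))
    (r := fun p => |(σ p.1 p.2 : ℝ)| * (|f p.1 - σ p.1 p.2 * f p.2| * (|f p.1| + |f p.2|)))
    (f := fun p => |(σ p.1 p.2 : ℝ)| * (f p.1 - σ p.1 p.2 * f p.2) ^ 2)
    (g := fun p => |(σ p.1 p.2 : ℝ)| * (|f p.1| + |f p.2|) ^ 2)
    (fun p _ => by positivity) (fun p _ => by positivity)
    fun p _ => le_of_eq (by rw [mul_pow, mul_pow, sq_abs (f p.1 - _)]; ring)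
  simp only [Fintype.sum_prod_type] at hcauchy
  have hparallelogram : ∑ x, ∑ y, |(σ x y : ℝ)| * (|f x| + |f y|) ^ 2 ≤
      4 * D * ∑ x, m x * f x ^ 2 := by
    calc _ ≤ ∑ x, ∑ y, 2 * (|(σ x y : ℝ)| * (f x ^ 2 + f y ^ 2)) := by
          refine Finset.sum_le_sum fun x _ => Finset.sum_le_sum fun y _ => ?_
          rw [← sq_abs (f x), ← sq_abs (f y), mul_left_comm]
          exact mul_le_mul_of_nonneg_left (add_sq_le ..) (abs_nonneg _)
      _ ≤ _ := by
          simp only [← Finset.mul_sum]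
          linarith [sum_abs_mul_sq_add_sq_le hsymm hdeg f]
  have henergy : ∑ x, ∑ y, |(σ x y : ℝ)| * (f x - σ x y * f y) ^ 2 = 2 * signedEnergy σ f := by
    unfold signedEnergy
    ring
  rw [henergy] at hcauchy
  exact hcauchy.trans (mul_le_mul_of_nonneg_left hparallelogram
    (mul_nonneg two_pos.le (signedEnergy_nonneg σ f)))

/-- Cheeger's inequality for signed graphs: integrating the hypothesis over the levels `t` bounds
`h ∑ m f²` by `∑ |f x - σ(x, y) f y| (|f x| + |f y|)`, to which Cauchy–Schwarz applies. -/
theorem sq_mul_sum_le_signedEnergy {σ : X → X → SignType} (hsymm : ∀ x y, σ x y = σ y x)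
    {m : X → ℝ} (hm : ∀ x, 0 ≤ m x) {D : ℝ} (hD : 0 ≤ D)
    (hdeg : ∀ x, ∑ y, |(σ x y : ℝ)| ≤ D * m x) (f : X → ℝ) {h : ℝ} (hh : 0 ≤ h)
    (hlevel : ∀ t, 0 < t → h * ∑ x, m x * |levelSign t (f x)| ≤
      signedVariation σ fun x => levelSign t (f x)) :
    h ^ 2 * ∑ x, m x * f x ^ 2 ≤ 2 * D * signedEnergy σ f := by
  set N := ∑ x, m x * f x ^ 2
  have hN : 0 ≤ N := Finset.sum_nonneg fun x _ => mul_nonneg (hm x) (sq_nonneg _)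
  have hvariation : h * N ≤
      (∑ x, ∑ y, |(σ x y : ℝ)| * (|f x - σ x y * f y| * (|f x| + |f y|))) / 2 :=
    calc h * N = ∫ t in Set.Ioi 0, h * ∑ x, m x * |levelSign t (f x)| := by
          rw [integral_const_mul, integral_sum_mul_abs_levelSign]
      _ ≤ ∫ t in Set.Ioi 0, signedVariation σ fun x => levelSign t (f x) :=
          setIntegral_mono_on ((integrable_finsetSum _ fun x _ =>
            (integrableOn_levelSign (f x)).abs.const_mul _).const_mul _)
            (integrableOn_signedVariation_levelSign σ f) measurableSet_Ioi hlevel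
      _ ≤ _ := integral_signedVariation_levelSign_le σ f
  have hsq : (2 * (h * N)) ^ 2 ≤ 2 * signedEnergy σ f * (4 * D * N) :=
    (pow_le_pow_left₀ (by positivity) (by linarith) 2).trans (sq_sum_abs_sub_mul_le hsymm hdeg f)
  have henergy := signedEnergy_nonneg σ f
  rcases hN.eq_or_lt with hzero | hpos
  · rw [← hzero, mul_zero]
    positivity
  · exact le_of_mul_le_mul_right (by linarith : h ^ 2 * N * N ≤ 2 * D * signedEnergy σ f * N) hpos

end SignedGraph

section Merging

variable {ι : Type*}

theorem exists_subset_le_sum_le {a : ι → ℝ} {b c : ℝ} (hc : 0 ≤ c) (hcb : 2 * c ≤ b)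
    (P : Finset ι) (hab : ∀ p ∈ P, a p ≤ b) (hP : c ≤ ∑ p ∈ P, a p) :
    ∃ Q ⊆ P, c ≤ ∑ p ∈ Q, a p ∧ ∑ p ∈ Q, a p ≤ b := by
  classical
  induction P using Finset.induction_on with
  | empty => exact ⟨∅, subset_rfl, hP, by simpa only [Finset.sum_empty] using by linarith⟩
  | insert p P hp ih =>
    by_cases hrest : c ≤ ∑ p ∈ P, a p
    · obtain ⟨Q, hQ, hQsum⟩ := ih (fun q hq => hab q (Finset.mem_insert_of_mem hq)) hrest
      exact ⟨Q, hQ.trans (Finset.subset_insert _ _), hQsum⟩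
    by_cases hsingle : c ≤ a p
    · exact ⟨{p}, by simp, by simpa using hsingle, by simpa using hab p (by simp)⟩
    · refine ⟨insert p P, subset_rfl, hP, ?_⟩
      rw [Finset.sum_insert hp]
      linarith

theorem pairwise_disjoint_finCons {j : ℕ} {Q : Finset ι} {R : Fin j → Finset ι}
    (hQ : ∀ i, Disjoint Q (R i)) (hR : Pairwise fun i i' => Disjoint (R i) (R i')) :
    Pairwise fun i i' => Disjoint ((Fin.cons Q R : Fin (j + 1) → Finset ι) i)
      ((Fin.cons Q R : Fin (j + 1) → Finset ι) i') := by
  refine Fin.cases ?_ fun i => ?_ <;> refine Fin.cases ?_ fun i' => ?_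
  · exact fun h => absurd rfl h
  · exact fun _ => hQ i'
  · exact fun _ => (hQ i).symm
  · exact fun h => hR fun hi => h (congrArg Fin.succ hi)

theorem exists_disjoint_le_sum {a : ι → ℝ} {b c : ℝ} (hc : 0 ≤ c) (hcb : 2 * c ≤ b) (j : ℕ)
    (P : Finset ι) (hab : ∀ p ∈ P, a p ≤ b) (hP : j * b + c ≤ ∑ p ∈ P, a p + b) :
    ∃ Q : Fin j → Finset ι, (∀ i, Q i ⊆ P) ∧ Pairwise (fun i i' => Disjoint (Q i) (Q i')) ∧
      ∀ i, c ≤ ∑ p ∈ Q i, a p := by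
  classical
  induction j generalizing P with
  | zero => exact ⟨fun i => i.elim0, fun i => i.elim0, fun i => i.elim0, fun i => i.elim0⟩
  | succ j ih =>
    push_cast at hP
    have hj : 0 ≤ (j : ℝ) * b := mul_nonneg j.cast_nonneg (by linarith)
    obtain ⟨Q, hQP, hQc, hQb⟩ := exists_subset_le_sum_le hc hcb P hab (by linarith)
    obtain ⟨R, hRP, hRdisj, hRc⟩ := ih (P \ Q) (fun p hp => hab p (Finset.sdiff_subset hp))
      (by linarith [Finset.sum_sdiff (f := a) hQP])
    exact ⟨Fin.cons Q R, Fin.cases hQP fun i => (hRP i).trans Finset.sdiff_subset,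
      pairwise_disjoint_finCons
        (fun i => Finset.disjoint_of_subset_right (hRP i) Finset.disjoint_sdiff) hRdisj,
      Fin.cases hQc hRc⟩

end Merging

section UpToSign

variable {E : Type*} [SeminormedAddCommGroup E]

/-- The space `E` with the pseudometric `min ‖v - w‖ ‖v + w‖`, in which `v` and `-v` have
distance `0`. On the unit sphere this is the chordal metric of the projective space. -/
structure UpToSign (E : Type*) where
  mk ::
  out : E

namespace UpToSign

noncomputable instance : PseudoMetricSpace (UpToSign E) where
  dist p q := min ‖p.out - q.out‖ ‖p.out + q.out‖
  dist_self p := by simp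
  dist_comm p q := by rw [norm_sub_rev, add_comm p.out]
  dist_triangle p q r := by
    have hsub_sub := norm_sub_le_norm_sub_add_norm_sub p.out q.out r.out
    have hsub_add : ‖p.out + r.out‖ ≤ ‖p.out - q.out‖ + ‖q.out + r.out‖ := by
      rw [show p.out + r.out = p.out - q.out + (q.out + r.out) by abel]
      exact norm_add_le _ _
    have hadd_sub : ‖p.out + r.out‖ ≤ ‖p.out + q.out‖ + ‖q.out - r.out‖ := by
      rw [show p.out + r.out = p.out + q.out - (q.out - r.out) by abel]
      exact norm_sub_le _ _
    have hadd_add : ‖p.out - r.out‖ ≤ ‖p.out + q.out‖ + ‖q.out + r.out‖ := by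
      rw [show p.out - r.out = p.out + q.out - (q.out + r.out) by abel]
      exact norm_sub_le _ _
    rcases min_choice ‖p.out - q.out‖ ‖p.out + q.out‖ with hpq | hpq <;>
      rcases min_choice ‖q.out - r.out‖ ‖q.out + r.out‖ with hqr | hqr <;>
      rw [hpq, hqr, min_le_iff] <;> tauto

theorem dist_def (p q : UpToSign E) : dist p q = min ‖p.out - q.out‖ ‖p.out + q.out‖ := rfl

theorem setOf_dist_mk_lt (v : E) (r : ℝ) :
    {c | dist (mk v) (mk c) < r} = Metric.ball v r ∪ Metric.ball (-v) r := by
  ext c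
  rw [Set.mem_ofPred_eq, dist_def, min_lt_iff, Set.mem_union, mem_ball_iff_norm',
    mem_ball_iff_norm, sub_neg_eq_add, add_comm c]

end UpToSign

end UpToSign

section BallCarving

open MeasureTheory

theorem exists_pos_le_of_integral_le {α : Type*} [MeasurableSpace α] {μ : Measure α}
    {f g : α → ℝ} (hf : Integrable f μ) (hg : Integrable g μ) (hf₀ : 0 ≤ f) (hg₀ : 0 ≤ g)
    (hpos : 0 < ∫ c, g c ∂μ) (hle : ∫ c, f c ∂μ ≤ ∫ c, g c ∂μ) : ∃ c, 0 < g c ∧ f c ≤ g c := by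
  by_contra! hlt
  have hgf : 0 ≤ f - g := fun c => sub_nonneg.2 <| by
    rcases (hg₀ c).eq_or_lt with hzero | hc
    · exact hzero ▸ hf₀ c
    · exact (hlt c hc).le
  have hzero : ∫ c, (f - g) c ∂μ = 0 :=
    le_antisymm (by simpa only [Pi.sub_apply, integral_sub hf hg, sub_nonpos]) (integral_nonneg hgf)
  rw [integral_eq_zero_iff_of_nonneg hgf (hf.sub hg)] at hzero
  refine hpos.ne' (integral_eq_zero_of_ae (hzero.mono fun c hc => ?_))
  by_contra hgc
  exact (sub_pos.2 (hlt c ((hg₀ c).lt_of_ne' hgc))).ne' hc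

variable {E : Type*} [NormedAddCommGroup E] [NormedSpace ℝ E] [FiniteDimensional ℝ E]

theorem addHaar_real_setOf_dist_mk_lt [MeasurableSpace E] [BorelSpace E] (μ : Measure E)
    [μ.IsAddHaarMeasure] {v : E} {r : ℝ} (hr : 0 < r) (hv : r ≤ ‖v‖) :
    μ.real {c | dist (UpToSign.mk v) (UpToSign.mk c) < r} =
      2 * (r ^ Module.finrank ℝ E * μ.real (Metric.ball 0 1)) := by
  have hdisj : Disjoint (Metric.ball v r) (Metric.ball (-v) r) := Metric.ball_disjoint_ball <| by
    rw [dist_eq_norm, sub_neg_eq_add, ← two_smul ℝ v, norm_smul, Real.norm_two]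
    linarith
  have hball : ∀ z : E, μ.real (Metric.ball z r) =
      r ^ Module.finrank ℝ E * μ.real (Metric.ball 0 1) := fun z => by
    rw [Measure.real, Measure.addHaar_ball_of_pos _ _ hr, ENNReal.toReal_mul,
      ENNReal.toReal_ofReal (by positivity), Measure.real]
  rw [UpToSign.setOf_dist_mk_lt, measureReal_union hdisj measurableSet_ball measure_ball_lt_top.ne
    measure_ball_lt_top.ne, hball, hball, two_mul]

variable {X : Type*}

theorem integral_sum_filter_dist_mk_lt [MeasurableSpace E] [BorelSpace E] (μ : Measure E)
    [μ.IsAddHaarMeasure] {u : X → E} (w : X → ℝ) {Y : Finset X} {r : ℝ} (hr : 0 < r)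
    (hru : ∀ x ∈ Y, r ≤ ‖u x‖) :
    Integrable (fun c => ∑ x ∈ Y with dist (UpToSign.mk (u x)) (UpToSign.mk c) < r, w x) μ ∧
      ∫ c, ∑ x ∈ Y with dist (UpToSign.mk (u x)) (UpToSign.mk c) < r, w x ∂μ =
        r ^ Module.finrank ℝ E * (2 * μ.real (Metric.ball 0 1) * ∑ x ∈ Y, w x) := by
  have hmeas : ∀ x, MeasurableSet {c | dist (UpToSign.mk (u x)) (UpToSign.mk c) < r} := fun x => by
    rw [UpToSign.setOf_dist_mk_lt]
    exact measurableSet_ball.union measurableSet_ball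
  have hindicator : ∀ x c, (if dist (UpToSign.mk (u x)) (UpToSign.mk c) < r then w x else 0) =
      {c | dist (UpToSign.mk (u x)) (UpToSign.mk c) < r}.indicator (fun _ => w x) c :=
    fun x c => by simp only [Set.indicator_apply, Set.mem_ofPred_eq]
  have hint : ∀ x, Integrable
      ({c | dist (UpToSign.mk (u x)) (UpToSign.mk c) < r}.indicator fun _ => w x) μ := fun x => by
    refine (integrable_indicator_iff (hmeas x)).2 (integrableOn_const ?_)
    rw [UpToSign.setOf_dist_mk_lt]
    exact (measure_union_lt_top measure_ball_lt_top measure_ball_lt_top).ne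
  simp only [Finset.sum_filter, hindicator]
  refine ⟨integrable_finsetSum _ fun x _ => hint x, ?_⟩
  rw [integral_finsetSum _ fun x _ => hint x, Finset.mul_sum, Finset.mul_sum]
  refine Finset.sum_congr rfl fun x hx => ?_
  rw [integral_indicator_const _ (hmeas x), addHaar_real_setOf_dist_mk_lt μ hr (hru x hx),
    smul_eq_mul]
  ring

theorem exists_pow_mul_sum_filter_dist_lt_le {u : X → E} {w : X → ℝ} (hw : ∀ x, 0 ≤ w x)
    {r r' : ℝ} (hr : 0 < r) (hr' : 0 < r') (hru : ∀ x, r ≤ ‖u x‖) (hru' : ∀ x, r' ≤ ‖u x‖)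
    {Y : Finset X} (hY : 0 < ∑ x ∈ Y, w x) :
    ∃ c : UpToSign E, 0 < ∑ x ∈ Y with dist (UpToSign.mk (u x)) c < r, w x ∧
      (r / r') ^ Module.finrank ℝ E * ∑ x ∈ Y with dist (UpToSign.mk (u x)) c < r', w x ≤
        ∑ x ∈ Y with dist (UpToSign.mk (u x)) c < r, w x := by
  borelize E
  let μ : Measure E := Measure.addHaar
  obtain ⟨hint, hintegral⟩ := integral_sum_filter_dist_mk_lt μ w hr fun x (_ : x ∈ Y) =>
    hru x
  obtain ⟨hint', hintegral'⟩ := integral_sum_filter_dist_mk_lt μ w hr' fun x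
    (_ : x ∈ Y) => hru' x
  have hball : 0 < μ.real (Metric.ball 0 1) :=
    ENNReal.toReal_pos (Metric.measure_ball_pos _ _ one_pos).ne' measure_ball_lt_top.ne
  obtain ⟨c, hc⟩ := exists_pos_le_of_integral_le
    (hint'.const_mul ((r / r') ^ Module.finrank ℝ E)) hint
    (fun c => mul_nonneg (by positivity) (Finset.sum_nonneg fun x _ => hw x))
    (fun c => Finset.sum_nonneg fun x _ => hw x) (by rw [hintegral]; positivity)
    (by rw [integral_const_mul, hintegral, hintegral', ← mul_assoc, ← mul_pow,
      div_mul_cancel₀ _ hr'.ne'])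
  exact ⟨UpToSign.mk c, hc⟩

/-- Ball carving: choose a center `c` at which the ball of radius `r` has at least the fraction `q`
of the weight of the ball of radius `r'`, take the small ball as a piece, discard the rest of the
large ball and repeat. -/
theorem exists_ball_carving {M : Type*} [PseudoMetricSpace M] {p : X → M} {w : X → ℝ}
    (hw : ∀ x, 0 ≤ w x) {q r r' : ℝ} (hrr' : r < r')
    (hcenter : ∀ Y : Finset X, 0 < ∑ x ∈ Y, w x → ∃ c, 0 < ∑ x ∈ Y with dist (p x) c < r, w x ∧
      q * ∑ x ∈ Y with dist (p x) c < r', w x ≤ ∑ x ∈ Y with dist (p x) c < r, w x)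
    (Y : Finset X) :
    ∃ P : Finset (Finset X), (∀ S ∈ P, S ⊆ Y ∧ ∃ c, ∀ x ∈ S, dist (p x) c < r) ∧
      (P : Set (Finset X)).Pairwise (fun S T => ∀ x ∈ S, ∀ y ∈ T, r' - r ≤ dist (p x) (p y)) ∧
      q * ∑ x ∈ Y, w x ≤ ∑ S ∈ P, ∑ x ∈ S, w x := by
  classical
  induction Y using Finset.strongInduction with
  | H Y ih =>
    rcases (Finset.sum_nonneg fun x (_ : x ∈ Y) => hw x).eq_or_lt with hY | hY
    · exact ⟨∅, by simp, by simp, by simp [← hY]⟩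
    obtain ⟨c, hpos, hc⟩ := hcenter Y hY
    set S := Y.filter fun x => dist (p x) c < r with hS
    obtain ⟨x₀, hx₀, -⟩ := Finset.exists_ne_zero_of_sum_ne_zero hpos.ne'
    rw [hS, Finset.mem_filter] at hx₀
    obtain ⟨P, hPY, hPsep, hPsum⟩ := ih (Y.filter fun x => ¬ dist (p x) c < r')
      (Finset.filter_ssubset.2 ⟨x₀, hx₀.1, not_not.2 (hx₀.2.trans hrr')⟩)
    have hfar : ∀ T ∈ P, ∀ y ∈ T, r' ≤ dist (p y) c := fun T hT y hy =>
      not_lt.1 (Finset.mem_filter.1 ((hPY T hT).1 hy)).2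
    have hsep : ∀ T ∈ P, ∀ x ∈ S, ∀ y ∈ T, r' - r ≤ dist (p x) (p y) := fun T hT x hx y hy => by
      linarith [hfar T hT y hy, (Finset.mem_filter.1 hx).2, dist_triangle_left (p y) c (p x)]
    have hSP : S ∉ P := fun h =>
      (hfar S h x₀ (Finset.mem_filter.2 hx₀)).not_gt (hx₀.2.trans hrr')
    refine ⟨insert S P, ?_, ?_, ?_⟩
    · refine (Finset.forall_mem_insert _ _ _).2 ⟨⟨Finset.filter_subset _ _, c, fun x hx =>
        (Finset.mem_filter.1 hx).2⟩, fun T hT => ⟨(hPY T hT).1.trans (Finset.filter_subset _ _),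
        (hPY T hT).2⟩⟩
    · rw [Finset.coe_insert]
      exact hPsep.insert fun T hT _ => ⟨hsep T hT, fun x hx y hy =>
        dist_comm (p y) (p x) ▸ hsep T hT y hy x hx⟩
    · rw [Finset.sum_insert hSP,
        ← Finset.sum_filter_add_sum_filter_not Y (fun x => dist (p x) c < r'), mul_add]
      exact add_le_add hc hPsum

end BallCarving

section Isotropic

variable {X E : Type*} [Fintype X] [NormedAddCommGroup E] [InnerProductSpace ℝ E]

/-- The weights `w` put the vectors `u` in isotropic position, that is, `∑ w x ⟪u x, v⟫² = ‖v‖²`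
for all `v`. -/
def IsIsotropic (w : X → ℝ) (u : X → E) : Prop :=
  ∀ v, ∑ x, w x * inner ℝ (u x) v ^ 2 = ‖v‖ ^ 2

theorem IsIsotropic.sum_eq_finrank [FiniteDimensional ℝ E] {w : X → ℝ} {u : X → E}
    (hiso : IsIsotropic w u) (hu : ∀ x, ‖u x‖ = 1) : ∑ x, w x = Module.finrank ℝ E := by
  let e := stdOrthonormalBasis ℝ E
  have hparseval : ∀ x, ∑ i, inner ℝ (u x) (e i) ^ 2 = 1 := fun x => by
    simpa only [hu, one_pow, Real.norm_eq_abs, sq_abs] using e.sum_sq_norm_inner_left (u x)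
  calc ∑ x, w x = ∑ x, ∑ i, w x * inner ℝ (u x) (e i) ^ 2 := by
        simp only [← Finset.mul_sum, hparseval, mul_one]
    _ = ∑ i, ∑ x, w x * inner ℝ (u x) (e i) ^ 2 := Finset.sum_comm
    _ = Module.finrank ℝ E := by
        simp only [hiso (e _), e.norm_eq_one, one_pow, Finset.sum_const, Finset.card_univ,
          Fintype.card_fin, nsmul_eq_mul, mul_one]

theorem one_sub_sq_mul_norm_sq_le_inner_sq {z : E} (hz : ‖z‖ = 1) {c : UpToSign E} {r : ℝ}
    (hr : r ≤ 1) (hc : dist (UpToSign.mk z) c < r) :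
    (1 - r ^ 2) * ‖c.out‖ ^ 2 ≤ inner ℝ z c.out ^ 2 := by
  have hr₀ : 0 ≤ 1 - r ^ 2 := by nlinarith [dist_nonneg.trans_lt hc]
  have habs : 1 - r ^ 2 + ‖c.out‖ ^ 2 ≤ 2 * |inner ℝ z c.out| := by
    rcases min_lt_iff.1 hc with h | h
    · have := pow_lt_pow_left₀ h (norm_nonneg _) two_ne_zero
      rw [norm_sub_sq_real, hz] at this
      linarith [le_abs_self (inner ℝ z c.out)]
    · have := pow_lt_pow_left₀ h (norm_nonneg _) two_ne_zero
      rw [norm_add_sq_real, hz] at this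
      linarith [neg_le_abs (inner ℝ z c.out)]
  have hsq := pow_le_pow_left₀ (by positivity) habs 2
  rw [mul_pow, sq_abs] at hsq
  linarith [four_mul_le_sq_add (1 - r ^ 2) (‖c.out‖ ^ 2)]

theorem IsIsotropic.one_sub_sq_mul_sum_le_one {w : X → ℝ} {u : X → E} (hiso : IsIsotropic w u)
    (hu : ∀ x, ‖u x‖ = 1) (hw : ∀ x, 0 ≤ w x) {S : Finset X} {c : UpToSign E} {r : ℝ}
    (hr : r ≤ 1) (hS : ∀ x ∈ S, dist (UpToSign.mk (u x)) c < r) :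
    (1 - r ^ 2) * ∑ x ∈ S, w x ≤ 1 := by
  rcases S.eq_empty_or_nonempty with rfl | ⟨x₀, hx₀⟩
  · simp
  have hc : 0 < ‖c.out‖ := by
    by_contra! hzero
    have hdist := hS x₀ hx₀
    rw [UpToSign.dist_def, norm_le_zero_iff.1 hzero, sub_zero, add_zero, min_self, hu] at hdist
    linarith
  refine le_of_mul_le_mul_right ?_ (pow_pos hc 2)
  calc (1 - r ^ 2) * (∑ x ∈ S, w x) * ‖c.out‖ ^ 2
      = ∑ x ∈ S, w x * ((1 - r ^ 2) * ‖c.out‖ ^ 2) := by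
        rw [← Finset.sum_mul]
        ring
    _ ≤ ∑ x ∈ S, w x * inner ℝ (u x) c.out ^ 2 := Finset.sum_le_sum fun x hx =>
        mul_le_mul_of_nonneg_left (one_sub_sq_mul_norm_sq_le_inner_sq (hu x) hr (hS x hx)) (hw x)
    _ ≤ ∑ x, w x * inner ℝ (u x) c.out ^ 2 :=
        Finset.sum_le_sum_of_subset_of_nonneg (Finset.subset_univ _)
          fun x _ _ => mul_nonneg (hw x) (sq_nonneg _)
    _ = 1 * ‖c.out‖ ^ 2 := by rw [hiso, one_mul]

theorem one_sub_mul_div_le_div_add_pow {a b : ℝ} (ha : 0 < a) (hb : 0 ≤ b) (n : ℕ) :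
    1 - n * (b / a) ≤ (a / (a + b)) ^ n := by
  have hab : 0 < a + b := by linarith
  have hquot : a / (a + b) = 1 + -(b / (a + b)) := by
    field_simp
    ring
  have hle : b / (a + b) ≤ b / a := div_le_div_of_nonneg_left hb ha (by linarith)
  have hone : b / (a + b) ≤ 1 := (div_le_one hab).2 (by linarith)
  rw [hquot]
  refine le_trans ?_ (one_add_mul_le_pow (by linarith) n)
  linarith [mul_le_mul_of_nonneg_left hle n.cast_nonneg]

/-- The carving radii are `r = 8 k² δ` and `r + 2 δ`: the pieces have radius at most `(8 k)^(-1/2)`,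
hence weight at most `1 + 1 / (4 k)`, and by Bernoulli's inequality all but the fraction `1 / (4 k)`
of the total weight `k` is covered. -/
theorem IsIsotropic.exists_separated_pieces [FiniteDimensional ℝ E] {w : X → ℝ} {u : X → E}
    (hiso : IsIsotropic w u) (hu : ∀ x, ‖u x‖ = 1) (hw : ∀ x, 0 ≤ w x) {k : ℕ} (hk : 1 ≤ k)
    (hE : Module.finrank ℝ E = k) {δ : ℝ} (hδ : 0 < δ) (hδk : δ ^ 2 * (512 * k ^ 5) ≤ 1) :
    ∃ P : Finset (Finset X), (∀ S ∈ P, ∑ x ∈ S, w x ≤ 1 + 1 / (4 * k)) ∧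
      (P : Set (Finset X)).Pairwise (fun S T => ∀ x ∈ S, ∀ y ∈ T,
        2 * δ ≤ dist (UpToSign.mk (u x)) (UpToSign.mk (u y))) ∧
      k - 1 / 4 ≤ ∑ S ∈ P, ∑ x ∈ S, w x := by
  have hk₁ : (1 : ℝ) ≤ k := by exact_mod_cast hk
  set r := 8 * (k : ℝ) ^ 2 * δ with hr
  have hr₀ : 0 < r := by positivity
  have hrk : r ^ 2 * (8 * k) ≤ 1 := by
    linarith [show r ^ 2 * (8 * k) = δ ^ 2 * (512 * k ^ 5) by ring]
  have hr₁ : r + 2 * δ ≤ 1 := by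
    have hδr : 2 * δ ≤ r := by nlinarith [one_le_pow₀ hk₁ (n := 2)]
    have : r ≤ 1 / 2 := abs_le_of_sq_le_sq' (by nlinarith) (by norm_num) |>.2
    linarith
  obtain ⟨P, hPball, hPsep, hPsum⟩ := exists_ball_carving hw
    (by linarith : r < r + 2 * δ) (fun Y => exists_pow_mul_sum_filter_dist_lt_le hw hr₀
      (by linarith) (fun x => by linarith [hu x]) fun x => by linarith [hu x]) Finset.univ
  refine ⟨P, fun S hS => ?_, by simpa only [add_sub_cancel_left] using hPsep, ?_⟩
  · obtain ⟨c, hc⟩ := (hPball S hS).2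
    have hmass := hiso.one_sub_sq_mul_sum_le_one hu hw (by linarith) hc
    have hsq : 1 - 1 / (8 * (k : ℝ)) ≤ 1 - r ^ 2 :=
      sub_le_sub_left ((le_div_iff₀ (by positivity)).2 hrk) 1
    have hbound : 1 ≤ (1 - 1 / (8 * (k : ℝ))) * (1 + 1 / (4 * k)) := by
      rw [← sub_nonneg, show (1 - 1 / (8 * (k : ℝ))) * (1 + 1 / (4 * k)) - 1 =
        (4 * k - 1) / (32 * k ^ 2) by field_simp; ring]
      exact div_nonneg (by linarith) (by positivity)
    refine le_of_mul_le_mul_left ((hmass.trans hbound).trans ?_) (by nlinarith : 0 < 1 - r ^ 2)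
    exact mul_le_mul_of_nonneg_right hsq (by positivity)
  · rw [hiso.sum_eq_finrank hu, hE] at hPsum
    have hbernoulli := one_sub_mul_div_le_div_add_pow hr₀ (by linarith : 0 ≤ 2 * δ) k
    refine le_trans ?_ ((mul_le_mul_of_nonneg_right hbernoulli k.cast_nonneg).trans hPsum)
    rw [hr]
    exact le_of_eq (by field_simp; ring)

theorem IsIsotropic.exists_separated_groups [FiniteDimensional ℝ E] {w : X → ℝ} {u : X → E}
    (hiso : IsIsotropic w u) (hu : ∀ x, ‖u x‖ = 1) (hw : ∀ x, 0 ≤ w x) {k : ℕ} (hk : 1 ≤ k)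
    (hE : Module.finrank ℝ E = k) {δ : ℝ} (hδ : 0 < δ) (hδk : δ ^ 2 * (512 * k ^ 5) ≤ 1) :
    ∃ G : Fin k → Finset X, (∀ i, 1 / 2 ≤ ∑ x ∈ G i, w x) ∧
      Pairwise fun i j => ∀ x ∈ G i, ∀ y ∈ G j,
        2 * δ ≤ dist (UpToSign.mk (u x)) (UpToSign.mk (u y)) := by
  obtain ⟨P, hPmass, hPsep, hPsum⟩ := hiso.exists_separated_pieces hu hw hk hE hδ hδk
  classical
  have hinv : 0 ≤ 1 / (4 * (k : ℝ)) := by positivity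
  have hmul : (k : ℝ) * (1 + 1 / (4 * k)) = k + 1 / 4 := by field_simp
  obtain ⟨Q, hQP, hQdisj, hQmass⟩ := exists_disjoint_le_sum (c := 1 / 2) (by norm_num)
    (by linarith) k P hPmass (by linarith)
  refine ⟨fun i => (Q i).biUnion id, fun i => ?_, fun i j hij x hx y hy => ?_⟩
  · rw [Finset.sum_biUnion fun S hS T hT hST => Finset.disjoint_left.2 fun x hxS hxT => ?_]
    · exact hQmass i
    · have := hPsep (hQP i hS) (hQP i hT) hST x hxS x hxT
      rw [dist_self] at this
      linarith
  · obtain ⟨S, hS, hxS⟩ := Finset.mem_biUnion.1 hx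
    obtain ⟨T, hT, hyT⟩ := Finset.mem_biUnion.1 hy
    have hne : S ≠ T := fun h => Finset.disjoint_left.1 (hQdisj hij) hS (h ▸ hT)
    exact hPsep (hQP i hS) (hQP j hT) hne x hxS y hyT

end Isotropic

section Cutoff

variable {M : Type*} [PseudoMetricSpace M]

theorem abs_thickenedIndicator_sub_le {δ : ℝ} (hδ : 0 < δ) (S : Set M) (p q : M) :
    |(thickenedIndicator hδ S p : ℝ) - thickenedIndicator hδ S q| ≤ dist p q / δ := by
  have := (lipschitzWith_thickenedIndicator hδ S).dist_le_mul p q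
  rwa [NNReal.dist_eq, NNReal.coe_inv, Real.coe_toNNReal _ hδ.le, inv_mul_eq_div] at this

theorem thickenedIndicator_eq_zero_or_eq_zero {δ : ℝ} (hδ : 0 < δ) {S T : Set M}
    (hST : ∀ p ∈ S, ∀ q ∈ T, 2 * δ ≤ dist p q) (z : M) :
    thickenedIndicator hδ S z = 0 ∨ thickenedIndicator hδ T z = 0 := by
  by_contra! h
  obtain ⟨p, hp, hzp⟩ := Metric.mem_thickening_iff.1
    (not_imp_comm.1 (thickenedIndicator_zero hδ S) h.1)
  obtain ⟨q, hq, hzq⟩ := Metric.mem_thickening_iff.1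
    (not_imp_comm.1 (thickenedIndicator_zero hδ T) h.2)
  linarith [hST p hp q hq, dist_triangle_left p q z]

theorem IsIsotropic.exists_cutoffs {X E : Type*} [Fintype X] [NormedAddCommGroup E]
    [InnerProductSpace ℝ E] [FiniteDimensional ℝ E] {w : X → ℝ} {u : X → E}
    (hiso : IsIsotropic w u) (hu : ∀ x, ‖u x‖ = 1) (hw : ∀ x, 0 ≤ w x) {k : ℕ} (hk : 1 ≤ k)
    (hE : Module.finrank ℝ E = k) {δ : ℝ} (hδ : 0 < δ) (hδk : δ ^ 2 * (512 * k ^ 5) ≤ 1) :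
    ∃ θ : Fin k → X → ℝ, (∀ i x, |θ i x| ≤ 1) ∧
      (∀ i x y, |θ i x - θ i y| ≤ dist (UpToSign.mk (u x)) (UpToSign.mk (u y)) / δ) ∧
      (∀ i, 1 / 2 ≤ ∑ x, w x * θ i x ^ 2) ∧ Pairwise fun i j => ∀ x, θ i x = 0 ∨ θ j x = 0 := by
  obtain ⟨G, hGmass, hGsep⟩ := hiso.exists_separated_groups hu hw hk hE hδ hδk
  let S : Fin k → Set (UpToSign E) := fun i => (fun x => UpToSign.mk (u x)) '' G i
  refine ⟨fun i x => thickenedIndicator hδ (S i) (UpToSign.mk (u x)), fun i x => ?_,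
    fun i x y => abs_thickenedIndicator_sub_le hδ (S i) _ _, fun i => ?_, fun i j hij x => ?_⟩
  · rw [NNReal.abs_eq]
    exact_mod_cast thickenedIndicator_le_one hδ (S i) _
  · refine (hGmass i).trans ((Finset.sum_le_sum fun x hx => le_of_eq ?_).trans
      (Finset.sum_le_sum_of_subset_of_nonneg (Finset.subset_univ (G i))
        fun x _ _ => mul_nonneg (hw x) (sq_nonneg _)))
    beta_reduce
    rw [thickenedIndicator_one hδ (S i) (Set.mem_image_of_mem _ hx), NNReal.coe_one, one_pow,
      mul_one]
  · have hsep : ∀ p ∈ S i, ∀ q ∈ S j, 2 * δ ≤ dist p q := by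
      rintro _ ⟨y, hy, rfl⟩ _ ⟨z, hz, rfl⟩
      exact hGsep hij y hy z hz
    beta_reduce
    exact_mod_cast thickenedIndicator_eq_zero_or_eq_zero hδ hsep (UpToSign.mk (u x))

end Cutoff

section Directions

variable {E : Type*} [NormedAddCommGroup E] [NormedSpace ℝ E]

theorem exists_norm_eq_one_and_eq_norm_smul [Nontrivial E] (v : E) :
    ∃ u : E, ‖u‖ = 1 ∧ v = ‖v‖ • u := by
  rcases eq_or_ne v 0 with rfl | hv
  · obtain ⟨u, hu⟩ := exists_norm_eq E zero_le_one
    exact ⟨u, hu, by rw [norm_zero, zero_smul]⟩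
  · have hv' := norm_ne_zero_iff.2 hv
    exact ⟨‖v‖⁻¹ • v, by rw [norm_smul, norm_inv, norm_norm, inv_mul_cancel₀ hv'],
      (smul_inv_smul₀ hv' v).symm⟩

theorem norm_signType_smul {s : SignType} (hs : s ≠ 0) (v : E) : ‖(s : ℝ) • v‖ = ‖v‖ := by
  cases s <;> simp_all

theorem dist_mk_le_norm_sub_smul {s : SignType} (hs : s ≠ 0) (u v : E) :
    dist (UpToSign.mk u) (UpToSign.mk v) ≤ ‖u - (s : ℝ) • v‖ := by
  cases s <;> simp_all [UpToSign.dist_def]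

theorem norm_mul_dist_mk_le {a b u v : E} (hu : ‖u‖ = 1) (ha : a = ‖a‖ • u) (hb : b = ‖b‖ • v)
    {s : SignType} (hs : s ≠ 0) :
    ‖b‖ * dist (UpToSign.mk u) (UpToSign.mk v) ≤ 2 * ‖a - (s : ℝ) • b‖ := by
  calc ‖b‖ * dist (UpToSign.mk u) (UpToSign.mk v) ≤ ‖b‖ * ‖u - (s : ℝ) • v‖ :=
        mul_le_mul_of_nonneg_left (dist_mk_le_norm_sub_smul hs u v) (norm_nonneg b)
    _ = ‖‖b‖ • u - (s : ℝ) • b‖ := by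
        rw [← norm_smul_of_nonneg (norm_nonneg b), smul_sub, smul_comm, ← hb]
    _ ≤ ‖‖b‖ • u - a‖ + ‖a - (s : ℝ) • b‖ := norm_sub_le_norm_sub_add_norm_sub _ _ _
    _ = |‖(s : ℝ) • b‖ - ‖a‖| + ‖a - (s : ℝ) • b‖ := by
        rw [norm_signType_smul hs, show ‖b‖ • u - a = (‖b‖ - ‖a‖) • u by rw [sub_smul, ← ha],
          norm_smul, hu, mul_one, Real.norm_eq_abs]
    _ ≤ 2 * ‖a - (s : ℝ) • b‖ := by
        linarith [abs_norm_sub_norm_le ((s : ℝ) • b) a, norm_sub_rev ((s : ℝ) • b) a]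

theorem norm_smul_sub_smul_smul_le {a b u v : E} (hu : ‖u‖ = 1) (ha : a = ‖a‖ • u)
    (hb : b = ‖b‖ • v) {s : SignType} (hs : s ≠ 0) {α β δ : ℝ} (hα : |α| ≤ 1) (hδ : 0 < δ)
    (hαβ : |α - β| ≤ dist (UpToSign.mk u) (UpToSign.mk v) / δ) :
    ‖α • a - (s : ℝ) • β • b‖ ≤ (1 + 2 / δ) * ‖a - (s : ℝ) • b‖ := by
  have hsplit : α • a - (s : ℝ) • β • b = α • (a - (s : ℝ) • b) + (α - β) • (s : ℝ) • b := by
    rw [smul_sub, sub_smul, smul_comm (s : ℝ) β]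
    abel
  calc ‖α • a - (s : ℝ) • β • b‖ ≤ |α| * ‖a - (s : ℝ) • b‖ + |α - β| * ‖b‖ := by
        rw [hsplit]
        refine (norm_add_le _ _).trans_eq ?_
        rw [norm_smul, norm_smul, norm_signType_smul hs, Real.norm_eq_abs, Real.norm_eq_abs]
    _ ≤ 1 * ‖a - (s : ℝ) • b‖ + dist (UpToSign.mk u) (UpToSign.mk v) / δ * ‖b‖ := by gcongr
    _ = ‖a - (s : ℝ) • b‖ + ‖b‖ * dist (UpToSign.mk u) (UpToSign.mk v) / δ := by ring
    _ ≤ ‖a - (s : ℝ) • b‖ + 2 * ‖a - (s : ℝ) • b‖ / δ := by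
        grw [norm_mul_dist_mk_le hu ha hb hs]
    _ = (1 + 2 / δ) * ‖a - (s : ℝ) • b‖ := by ring

end Directions

section Localization

theorem exists_pos_le_mul_of_sum_le {ι : Type*} {s : Finset ι} {a b : ι → ℝ} {C : ℝ}
    (ha : ∀ j ∈ s, 0 ≤ a j) (hb : ∀ j ∈ s, 0 ≤ b j) (hpos : 0 < ∑ j ∈ s, b j)
    (hle : ∑ j ∈ s, a j ≤ C * ∑ j ∈ s, b j) : ∃ j ∈ s, 0 < b j ∧ a j ≤ C * b j := by
  by_contra! hlt
  obtain ⟨j, hj, hbj⟩ := Finset.exists_ne_zero_of_sum_ne_zero hpos.ne'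
  refine hle.not_gt ?_
  rw [Finset.mul_sum]
  refine Finset.sum_lt_sum (fun i hi => ?_) ⟨j, hj, hlt j hj ((hb j hj).lt_of_ne' hbj)⟩
  rcases (hb i hi).eq_or_lt with hzero | hbi
  · rw [← hzero, mul_zero]
    exact ha i hi
  · exact (hlt i hi hbi).le

variable {X ι : Type*} [Fintype X] [Fintype ι]

theorem sum_signedEnergy (σ : X → X → SignType) (F : X → EuclideanSpace ℝ ι) :
    ∑ j, signedEnergy σ (fun x => F x j) =
      (∑ x, ∑ y, |(σ x y : ℝ)| * ‖F x - (σ x y : ℝ) • F y‖ ^ 2) / 2 := by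
  simp only [signedEnergy, EuclideanSpace.real_norm_sq_eq, Finset.mul_sum, PiLp.sub_apply,
    PiLp.smul_apply, smul_eq_mul]
  rw [← Finset.sum_div, Finset.sum_comm]
  exact congrArg (· / 2) (Finset.sum_congr rfl fun x _ => Finset.sum_comm)

theorem sum_signedEnergy_le_of_norm_sub_smul_le {σ : X → X → SignType}
    {F G : X → EuclideanSpace ℝ ι} {C : ℝ} (hFG : ∀ x y, σ x y ≠ 0 →
      ‖G x - (σ x y : ℝ) • G y‖ ≤ C * ‖F x - (σ x y : ℝ) • F y‖) :
    ∑ j, signedEnergy σ (fun x => G x j) ≤ C ^ 2 * ∑ j, signedEnergy σ (fun x => F x j) := by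
  rw [sum_signedEnergy, sum_signedEnergy, ← mul_div_assoc]
  refine div_le_div_of_nonneg_right ?_ two_pos.le
  simp only [Finset.mul_sum]
  refine Finset.sum_le_sum fun x _ => Finset.sum_le_sum fun y _ => ?_
  by_cases hxy : σ x y = 0
  · simp [hxy]
  · rw [mul_left_comm, ← mul_pow]
    exact mul_le_mul_of_nonneg_left (pow_le_pow_left₀ (norm_nonneg _) (hFG x y hxy) 2)
      (abs_nonneg _)

theorem isIsotropic_mul_norm_sq [DecidableEq ι] {m : X → ℝ} {f : ι → X → ℝ}
    (hf : ∀ i j, ∑ x, m x * (f i x * f j x) = if i = j then 1 else 0) {u : X → EuclideanSpace ℝ ι}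
    (hu : ∀ x, WithLp.toLp 2 (f · x) = ‖WithLp.toLp 2 (f · x)‖ • u x) :
    IsIsotropic (fun x => m x * ‖WithLp.toLp 2 (f · x)‖ ^ 2) u := by
  intro v
  have hinner : ∀ x, ‖WithLp.toLp 2 (f · x)‖ * inner ℝ (u x) v = ∑ i, v i * f i x := fun x => by
    rw [← real_inner_smul_left, ← hu, PiLp.inner_apply]
    rfl
  have hexpand : ∀ x, m x * ‖WithLp.toLp 2 (f · x)‖ ^ 2 * inner ℝ (u x) v ^ 2 =
      ∑ i, ∑ j, v i * v j * (m x * (f i x * f j x)) := fun x => by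
    rw [mul_assoc, ← mul_pow, hinner, sq, Finset.sum_mul_sum]
    simp only [Finset.mul_sum]
    exact Finset.sum_congr rfl fun i _ => Finset.sum_congr rfl fun j _ => by ring
  simp only [hexpand]
  rw [Finset.sum_comm, EuclideanSpace.real_norm_sq_eq]
  refine Finset.sum_congr rfl fun i _ => ?_
  rw [Finset.sum_comm]
  simp only [← Finset.mul_sum, hf, mul_ite, mul_one, mul_zero, Finset.sum_ite_eq, Finset.mem_univ,
    if_true, sq]

theorem sum_sum_mul_mul_sq (m θ : X → ℝ) (f : ι → X → ℝ) :
    ∑ j, ∑ x, m x * (θ x * f j x) ^ 2 = ∑ x, m x * ‖WithLp.toLp 2 (f · x)‖ ^ 2 * θ x ^ 2 := by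
  rw [Finset.sum_comm]
  refine Finset.sum_congr rfl fun x _ => ?_
  rw [EuclideanSpace.real_norm_sq_eq, Finset.mul_sum, Finset.sum_mul]
  exact Finset.sum_congr rfl fun j _ => by ring

/-- Localization: the vector `(f₁ x, …, f_k x)` is cut off according to its direction. -/
theorem exists_disjoint_cutoffs_sum_signedEnergy_le {σ : X → X → SignType} {m : X → ℝ}
    (hm : ∀ x, 0 ≤ m x) {k : ℕ} (hk : 1 ≤ k) {f : Fin k → X → ℝ}
    (hf : ∀ i j, ∑ x, m x * (f i x * f j x) = if i = j then 1 else 0) {μ : ℝ}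
    (hμ : ∀ i, signedEnergy σ (f i) ≤ μ) :
    ∃ θ : Fin k → X → ℝ, (Pairwise fun i j => ∀ x, θ i x = 0 ∨ θ j x = 0) ∧
      ∀ i, 1 / 2 ≤ ∑ j, ∑ x, m x * (θ i x * f j x) ^ 2 ∧
        ∑ j, signedEnergy σ (fun x => θ i x * f j x) ≤ 4608 * k ^ 6 * μ := by
  have hk₁ : (1 : ℝ) ≤ k := by exact_mod_cast hk
  let F : X → EuclideanSpace ℝ (Fin k) := fun x => WithLp.toLp 2 (f · x)
  have : Nonempty (Fin k) := ⟨⟨0, hk⟩⟩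
  choose u hu hFu using fun x => exists_norm_eq_one_and_eq_norm_smul (F x)
  set δ : ℝ := (√(512 * k ^ 5))⁻¹ with hδdef
  have hδ : 0 < δ := by positivity
  have hδk : δ ^ 2 * (512 * k ^ 5) = 1 := by
    rw [hδdef, inv_pow, Real.sq_sqrt (by positivity), inv_mul_cancel₀ (by positivity)]
  have hδ₁ : δ ≤ 1 := inv_le_one_of_one_le₀
    (Real.one_le_sqrt.2 (by linarith [one_le_pow₀ hk₁ (n := 5)]))
  obtain ⟨θ, hθ₁, hθlip, hθmass, hθdisj⟩ := (isIsotropic_mul_norm_sq hf hFu).exists_cutoffs hu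
    (fun x => mul_nonneg (hm x) (sq_nonneg _)) hk finrank_euclideanSpace_fin hδ hδk.le
  refine ⟨θ, hθdisj, fun i => ⟨?_, ?_⟩⟩
  · rw [sum_sum_mul_mul_sq]
    exact hθmass i
  · calc ∑ j, signedEnergy σ (fun x => θ i x * f j x) ≤ (3 / δ) ^ 2 * ∑ j, signedEnergy σ (f j) :=
          sum_signedEnergy_le_of_norm_sub_smul_le (F := F) (G := fun x => θ i x • F x)
            fun x y hxy => (norm_smul_sub_smul_smul_le (hu x) (hFu x) (hFu y) hxy (hθ₁ i x) hδ
              (hθlip i x y)).trans (by gcongr; field_simp; linarith)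
      _ ≤ (3 / δ) ^ 2 * (k * μ) := by
          gcongr
          exact (Finset.sum_le_sum fun j _ => hμ j).trans_eq (by simp)
      _ = 4608 * k ^ 6 * μ := by
          rw [div_pow, eq_div_of_mul_eq (by positivity) hδk]
          field_simp
          ring

theorem exists_disjoint_support_signedEnergy_le {σ : X → X → SignType} {m : X → ℝ}
    (hm : ∀ x, 0 ≤ m x) {k : ℕ} (hk : 1 ≤ k) {f : Fin k → X → ℝ}
    (hf : ∀ i j, ∑ x, m x * (f i x * f j x) = if i = j then 1 else 0) {μ : ℝ}
    (hμ : ∀ i, signedEnergy σ (f i) ≤ μ) :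
    ∃ ψ : Fin k → X → ℝ, (Pairwise fun i j => ∀ x, ψ i x = 0 ∨ ψ j x = 0) ∧
      ∀ i, 0 < ∑ x, m x * ψ i x ^ 2 ∧
        signedEnergy σ (ψ i) ≤ 9216 * k ^ 6 * μ * ∑ x, m x * ψ i x ^ 2 := by
  have hμ₀ : 0 ≤ μ := (signedEnergy_nonneg σ _).trans (hμ ⟨0, hk⟩)
  obtain ⟨θ, hθdisj, hθ⟩ := exists_disjoint_cutoffs_sum_signedEnergy_le hm hk hf hμ
  have hselect : ∀ i, ∃ j ∈ Finset.univ, 0 < ∑ x, m x * (θ i x * f j x) ^ 2 ∧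
      signedEnergy σ (fun x => θ i x * f j x) ≤
        9216 * k ^ 6 * μ * ∑ x, m x * (θ i x * f j x) ^ 2 := fun i => by
    obtain ⟨hmass, henergy⟩ := hθ i
    refine exists_pos_le_mul_of_sum_le (fun j _ => signedEnergy_nonneg σ _)
      (fun j _ => Finset.sum_nonneg fun x _ => mul_nonneg (hm x) (sq_nonneg _)) (by linarith) ?_
    have := mul_le_mul_of_nonneg_left hmass (by positivity : 0 ≤ 9216 * (k : ℝ) ^ 6 * μ)
    linarith
  choose j _ hj using hselect
  exact ⟨fun i x => θ i x * f (j i) x, fun i i' hii' x => (hθdisj hii' x).imp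
    (mul_eq_zero_of_left · _) (mul_eq_zero_of_left · _), hj⟩

end Localization

section MinMax

variable {E : Type*} [NormedAddCommGroup E] [InnerProductSpace ℝ E] [FiniteDimensional ℝ E]
  {T : E →ₗ[ℝ] E} (hT : T.IsSymmetric) {n : ℕ} (hn : Module.finrank ℝ E = n)

include hT in
theorem inner_map_self_eq_sum (v : E) :
    inner ℝ v (T v) =
      ∑ j, hT.eigenvalues hn j * inner ℝ (hT.eigenvectorBasis hn j) v ^ 2 := by
  rw [← (hT.eigenvectorBasis hn).sum_inner_mul_inner v (T v)]
  refine Finset.sum_congr rfl fun j _ => ?_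
  rw [← hT, hT.apply_eigenvectorBasis, RCLike.ofReal_real_eq_id, id, real_inner_smul_left,
    real_inner_comm]
  ring

theorem inner_map_self_le_of_forall_lt {i : Fin n} {v : E}
    (hv : ∀ j < i, inner ℝ (hT.eigenvectorBasis hn j) v = 0) :
    inner ℝ v (T v) ≤ hT.eigenvalues hn i * ‖v‖ ^ 2 := by
  rw [inner_map_self_eq_sum hT hn, ← (hT.eigenvectorBasis hn).sum_sq_inner_right, Finset.mul_sum]
  refine Finset.sum_le_sum fun j _ => ?_
  rcases lt_or_ge j i with hji | hij
  · rw [hv j hji, zero_pow two_ne_zero, mul_zero, mul_zero]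
  · exact mul_le_mul_of_nonneg_right (hT.eigenvalues_antitone hn hij) (sq_nonneg _)

theorem exists_ne_zero_forall_inner_eq_zero {E F ι : Type*} [NormedAddCommGroup E]
    [InnerProductSpace ℝ E] [AddCommGroup F] [Module ℝ F] [FiniteDimensional ℝ F] [Fintype ι]
    (u : ι → E) (L : F →ₗ[ℝ] E) (h : Fintype.card ι < Module.finrank ℝ F) :
    ∃ c, c ≠ 0 ∧ ∀ j, inner ℝ (u j) (L c) = 0 := by
  let Φ : F →ₗ[ℝ] ι → ℝ := LinearMap.pi fun j => (innerₗ E (u j)).comp L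
  obtain ⟨c, hc, hc₀⟩ := Submodule.exists_mem_ne_zero_of_ne_bot
    (LinearMap.ker_ne_bot_of_finrank_lt (f := Φ) (by rwa [Module.finrank_fintype_fun_eq_card]))
  exact ⟨c, hc₀, congrFun (LinearMap.mem_ker.1 hc)⟩

theorem le_eigenvalues_of_forall_le_inner {F : Type*} [AddCommGroup F] [Module ℝ F]
    [FiniteDimensional ℝ F] {L : F →ₗ[ℝ] E} (hL : ∀ c, c ≠ 0 → L c ≠ 0) {i : Fin n}
    (hi : (i : ℕ) < Module.finrank ℝ F) {l : ℝ}
    (hl : ∀ c, l * ‖L c‖ ^ 2 ≤ inner ℝ (L c) (T (L c))) : l ≤ hT.eigenvalues hn i := by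
  obtain ⟨c, hc, horth⟩ := exists_ne_zero_forall_inner_eq_zero
    (fun j : Finset.Iio i => hT.eigenvectorBasis hn j) L
    (by rwa [Fintype.card_coe, Fin.card_Iio])
  refine le_of_mul_le_mul_right ((hl c).trans (inner_map_self_le_of_forall_lt hT hn fun j hj =>
    horth ⟨j, Finset.mem_Iio.2 hj⟩)) (by have := hL c hc; positivity)

end MinMax

section Weighted

open Matrix

variable {X : Type*} [Fintype X] [DecidableEq X]

theorem sort_roots_charpoly_eq_reverse {H : Matrix X X ℝ} (hH : H.IsHermitian) :
    H.charpoly.roots.sort (· ≤ ·) = (List.ofFn hH.eigenvalues₀).reverse := by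
  rw [hH.roots_charpoly_eq_eigenvalues₀, Fin.univ_val_map, ← Multiset.coe_reverse,
    Multiset.coe_sort]
  apply List.mergeSort_of_pairwise
  simp only [decide_eq_true_eq, List.pairwise_reverse, Function.comp_def,
    RCLike.ofReal_real_eq_id, id]
  exact List.pairwise_ofFn.2 fun i j hij => hH.eigenvalues₀_antitone hij.le

theorem getD_sort_roots_charpoly {H : Matrix X X ℝ} (hH : H.IsHermitian)
    (i : Fin (Fintype.card X)) :
    (H.charpoly.roots.sort (· ≤ ·)).getD (Fintype.card X - 1 - i) 0 = hH.eigenvalues₀ i := by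
  rw [sort_roots_charpoly_eq_reverse hH,
    List.getD_eq_getElem _ _ (by rw [List.length_reverse, List.length_ofFn]; lia),
    List.getElem_reverse, List.getElem_ofFn]
  congr 1
  ext
  simp only [List.length_ofFn]
  lia

/-- The matrix `D^(-1/2) S D^(-1/2)`, where `D` is the diagonal matrix of the weights `m` and the
entries of `D^(-1/2)` at points of weight `0` are `0`. For `m ≥ 0` it is a symmetric matrix with
the characteristic polynomial of `D⁻¹ S`. -/
noncomputable def normalizedMatrix (m : X → ℝ) (S : Matrix X X ℝ) : Matrix X X ℝ :=
  diagonal (fun x => √(m x)⁻¹) * S * diagonal fun x => √(m x)⁻¹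

theorem isHermitian_normalizedMatrix (m : X → ℝ) {S : Matrix X X ℝ} (hS : S.IsHermitian) :
    (normalizedMatrix m S).IsHermitian := by
  have := isHermitian_conjTranspose_mul_mul (diagonal fun x => √(m x)⁻¹) hS
  rwa [diagonal_conjTranspose, star_trivial] at this

theorem charpoly_normalizedMatrix {m : X → ℝ} (hm : ∀ x, 0 ≤ m x) (S : Matrix X X ℝ) :
    (normalizedMatrix m S).charpoly = (diagonal (fun x => (m x)⁻¹) * S).charpoly := by
  rw [normalizedMatrix, charpoly_mul_comm, ← Matrix.mul_assoc, diagonal_mul_diagonal]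
  simp only [Real.mul_self_sqrt (inv_nonneg.2 (hm _))]

theorem dotProduct_normalizedMatrix_mulVec (m : X → ℝ) (S : Matrix X X ℝ) (v : X → ℝ) :
    v ⬝ᵥ normalizedMatrix m S *ᵥ v =
      (fun x => √(m x)⁻¹ * v x) ⬝ᵥ S *ᵥ fun x => √(m x)⁻¹ * v x := by
  have hdiag : (diagonal fun x => √(m x)⁻¹) *ᵥ v = fun x => √(m x)⁻¹ * v x :=
    funext fun x => mulVec_diagonal _ _ x
  rw [normalizedMatrix, ← mulVec_mulVec, ← mulVec_mulVec, dotProduct_mulVec v,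
    ← mulVec_transpose, diagonal_transpose, hdiag]

theorem normalizedMatrix_mulVec_of_eq_zero {m : X → ℝ} {x : X} (hx : m x = 0) (S : Matrix X X ℝ)
    (v : X → ℝ) : (normalizedMatrix m S *ᵥ v) x = 0 := by
  rw [normalizedMatrix, Matrix.mul_assoc, ← mulVec_mulVec, mulVec_diagonal, hx, _root_.inv_zero,
    Real.sqrt_zero, zero_mul]

omit [DecidableEq X] in
theorem sum_mul_sqrt_inv_mul {m : X → ℝ} (hm : ∀ x, 0 ≤ m x) {v : X → ℝ}
    (hv : ∀ x, m x = 0 → v x = 0) (w : X → ℝ) :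
    ∑ x, m x * (√(m x)⁻¹ * v x * (√(m x)⁻¹ * w x)) = v ⬝ᵥ w := by
  refine Finset.sum_congr rfl fun x _ => ?_
  rcases (hm x).eq_or_lt with hx | hx
  · rw [hv x hx.symm, mul_zero, zero_mul, mul_zero, zero_mul]
  · rw [mul_mul_mul_comm, Real.mul_self_sqrt (inv_nonneg.2 hx.le), mul_inv_cancel_left₀ hx.ne']

theorem dotProduct_normalizedMatrix_mulVec_sqrt_mul {m : X → ℝ} (hm : ∀ x, 0 ≤ m x)
    {S : Matrix X X ℝ} (hS : S.IsHermitian) (hSm : ∀ x y, m x = 0 → S x y = 0) (f : X → ℝ) :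
    (fun x => √(m x) * f x) ⬝ᵥ normalizedMatrix m S *ᵥ (fun x => √(m x) * f x) =
      f ⬝ᵥ S *ᵥ f := by
  have hcancel : ∀ x, 0 < m x → √(m x)⁻¹ * (√(m x) * f x) = f x := fun x hx => by
    rw [Real.sqrt_inv, inv_mul_cancel_left₀ (Real.sqrt_pos.2 hx).ne']
  rw [dotProduct_normalizedMatrix_mulVec]
  simp only [dotProduct, mulVec, Finset.mul_sum]
  refine Finset.sum_congr rfl fun x _ => Finset.sum_congr rfl fun y _ => ?_
  rcases (hm x).eq_or_lt with hx | hx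
  · simp only [hSm x y hx.symm, zero_mul, mul_zero]
  rcases (hm y).eq_or_lt with hy | hy
  · simp only [← hS.apply x y, hSm y x hy.symm, star_zero, zero_mul, mul_zero]
  rw [hcancel x hx, hcancel y hy]

theorem inner_toEuclideanLin (N : Matrix X X ℝ) (v : EuclideanSpace ℝ X) :
    inner ℝ v (N.toEuclideanLin v) = v.ofLp ⬝ᵥ N *ᵥ v.ofLp := by
  rw [EuclideanSpace.inner_eq_star_dotProduct, star_trivial, dotProduct_comm]
  rfl

theorem le_eigenvalues₀_normalizedMatrix {m : X → ℝ} (hm : ∀ x, 0 ≤ m x) {S : Matrix X X ℝ}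
    (hS : S.IsHermitian) (hSm : ∀ x y, m x = 0 → S x y = 0) {F : Type*} [AddCommGroup F]
    [Module ℝ F] [FiniteDimensional ℝ F] {G : F →ₗ[ℝ] X → ℝ}
    (hG : ∀ c, c ≠ 0 → 0 < ∑ x, m x * G c x ^ 2) {i : Fin (Fintype.card X)}
    (hi : (i : ℕ) < Module.finrank ℝ F) {l : ℝ}
    (hl : ∀ c, l * ∑ x, m x * G c x ^ 2 ≤ G c ⬝ᵥ S *ᵥ G c) :
    l ≤ (isHermitian_normalizedMatrix m hS).eigenvalues₀ i := by
  let L : F →ₗ[ℝ] EuclideanSpace ℝ X :=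
    (WithLp.linearEquiv 2 ℝ (X → ℝ)).symm.toLinearMap ∘ₗ
      (diagonal fun x => √(m x)).mulVecLin ∘ₗ G
  have hLG : ∀ c, (L c).ofLp = fun x => √(m x) * G c x := fun c =>
    funext fun x => mulVec_diagonal _ _ x
  have hnorm : ∀ c, ‖L c‖ ^ 2 = ∑ x, m x * G c x ^ 2 := fun c => by
    rw [EuclideanSpace.real_norm_sq_eq]
    refine Finset.sum_congr rfl fun x _ => ?_
    rw [hLG, mul_pow, Real.sq_sqrt (hm x)]
  refine le_eigenvalues_of_forall_le_inner (L := L) _ _ (fun c hc hLc => ?_) hi fun c => ?_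
  · have := hnorm c
    rw [hLc, norm_zero, zero_pow two_ne_zero] at this
    exact (hG c hc).ne this
  · rw [hnorm, inner_toEuclideanLin, hLG,
      dotProduct_normalizedMatrix_mulVec_sqrt_mul hm hS hSm]
    exact hl c

omit [DecidableEq X] in
theorem exists_orthonormal_of_le_ncard {m : X → ℝ} {k : ℕ} (hk : k ≤ {x | 0 < m x}.ncard) :
    ∃ f : Fin k → X → ℝ, ∀ i j, ∑ x, m x * (f i x * f j x) = if i = j then 1 else 0 := by
  classical
  obtain ⟨p⟩ : Nonempty (Fin k ↪ {x // 0 < m x}) := Function.Embedding.nonempty_of_card_le <| by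
    rwa [Fintype.card_fin, ← Nat.card_eq_fintype_card, ← Set.coe_ofPred, Nat.card_coe_set_eq]
  refine ⟨fun i => Pi.single (p i) √(m (p i))⁻¹, fun i j => ?_⟩
  beta_reduce
  rw [Finset.sum_eq_single (p i : X)
    (fun x _ hx => by rw [Pi.single_eq_of_ne hx, zero_mul, mul_zero])
    (fun h => absurd (Finset.mem_univ _) h), Pi.single_eq_same]
  rcases eq_or_ne i j with rfl | hij
  · rw [Pi.single_eq_same, Real.mul_self_sqrt (inv_nonneg.2 (p i).2.le),
      mul_inv_cancel₀ (p i).2.ne', if_pos rfl]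
  · rw [Pi.single_eq_of_ne (fun h => hij (p.injective (Subtype.ext h))), mul_zero, mul_zero,
      if_neg hij]

theorem exists_orthonormal_eigenvalues₀_le_of_pos {m : X → ℝ} (hm : ∀ x, 0 ≤ m x)
    {S : Matrix X X ℝ} (hS : S.IsHermitian) {k : ℕ} {i : Fin (Fintype.card X)}
    (hki : k ≤ i + 1) (hpos : 0 < (isHermitian_normalizedMatrix m hS).eigenvalues₀ i) :
    ∃ f : Fin k → X → ℝ, (∀ a b, ∑ x, m x * (f a x * f b x) = if a = b then 1 else 0) ∧
      ∀ a, (isHermitian_normalizedMatrix m hS).eigenvalues₀ i ≤ f a ⬝ᵥ S *ᵥ f a := by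
  have hsymm := isSymmetric_toEuclideanLin_iff.2 (isHermitian_normalizedMatrix m hS)
  let index : Fin k → Fin (Fintype.card X) := Fin.castLE (hki.trans i.2)
  let e : Fin k → EuclideanSpace ℝ X := fun a =>
    hsymm.eigenvectorBasis finrank_euclideanSpace (index a)
  set lam := (isHermitian_normalizedMatrix m hS).eigenvalues₀
  have hle : ∀ a, lam i ≤ lam (index a) := fun a =>
    (isHermitian_normalizedMatrix m hS).eigenvalues₀_antitone
      (Fin.le_def.2 (Nat.lt_succ_iff.1 (a.2.trans_le hki)))
  have heigen : ∀ a, normalizedMatrix m S *ᵥ (e a).ofLp = lam (index a) • (e a).ofLp := fun a =>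
    congrArg WithLp.ofLp (hsymm.apply_eigenvectorBasis finrank_euclideanSpace (index a))
  have horth : ∀ a b, (e a).ofLp ⬝ᵥ (e b).ofLp = if a = b then 1 else 0 := fun a b => by
    have := orthonormal_iff_ite.1
      (hsymm.eigenvectorBasis finrank_euclideanSpace).orthonormal (index b) (index a)
    rw [EuclideanSpace.inner_eq_star_dotProduct, star_trivial] at this
    simpa only [index, Fin.castLE_inj, eq_comm] using this
  have hvanish : ∀ a x, m x = 0 → (e a).ofLp x = 0 := fun a x hx => by
    have := congrFun (heigen a) x
    rw [normalizedMatrix_mulVec_of_eq_zero hx, Pi.smul_apply, smul_eq_mul, zero_eq_mul] at this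
    exact this.resolve_left (hpos.trans_le (hle a)).ne'
  refine ⟨fun a x => √(m x)⁻¹ * (e a).ofLp x,
    fun a b => (sum_mul_sqrt_inv_mul hm (hvanish a) _).trans (horth a b), fun a => ?_⟩
  rw [← dotProduct_normalizedMatrix_mulVec, heigen, dotProduct_smul, horth, if_pos rfl,
    smul_eq_mul, mul_one]
  exact hle a

theorem exists_orthonormal_eigenvalues₀_le {m : X → ℝ} (hm : ∀ x, 0 ≤ m x) {S : Matrix X X ℝ}
    (hS : S.PosSemidef) {k : ℕ} (hk : k ≤ {x | 0 < m x}.ncard) {i : Fin (Fintype.card X)}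
    (hki : k ≤ i + 1) :
    ∃ f : Fin k → X → ℝ, (∀ a b, ∑ x, m x * (f a x * f b x) = if a = b then 1 else 0) ∧
      ∀ a, (isHermitian_normalizedMatrix m hS.isHermitian).eigenvalues₀ i ≤ f a ⬝ᵥ S *ᵥ f a := by
  rcases le_or_gt ((isHermitian_normalizedMatrix m hS.isHermitian).eigenvalues₀ i) 0 with hle | hpos
  · obtain ⟨f, hf⟩ := exists_orthonormal_of_le_ncard hk
    exact ⟨f, hf, fun a => hle.trans (hS.dotProduct_mulVec_nonneg (f a))⟩
  · exact exists_orthonormal_eigenvalues₀_le_of_pos hm hS.isHermitian hki hpos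

end Weighted

section SignPatterns

theorem sq_sum_of_pairwise_mul_eq_zero {ι R : Type*} [Fintype ι] [CommSemiring R] {t : ι → R}
    (ht : Pairwise fun i j => t i * t j = 0) : (∑ i, t i) ^ 2 = ∑ i, t i ^ 2 := by
  rw [sq, Finset.sum_mul_sum]
  refine Finset.sum_congr rfl fun i _ => ?_
  rw [Finset.sum_eq_single i (fun j _ hji => ht hji.symm) fun h => absurd (Finset.mem_univ i) h, sq]

theorem abs_signType_eq_sq (s : SignType) : |(s : ℝ)| = (s : ℝ) ^ 2 := by
  cases s <;> simp

variable {X ι : Type*} [Fintype ι] {χ : ι → X → SignType}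

theorem sum_abs_signType_le_one {s : ι → SignType} (hs : Pairwise fun i j => s i = 0 ∨ s j = 0) :
    ∑ i, |(s i : ℝ)| ≤ 1 := by
  have hsq : (∑ i, |(s i : ℝ)|) ^ 2 = ∑ i, |(s i : ℝ)| := by
    rw [sq_sum_of_pairwise_mul_eq_zero fun i j hij => by
      rcases hs hij with h | h <;> simp [h]]
    simp only [sq_abs, ← abs_signType_eq_sq]
  nlinarith

theorem sq_sum_mul_signType (hχ : Pairwise fun i j => ∀ x, χ i x = 0 ∨ χ j x = 0) (c : ι → ℝ)
    (x : X) : (∑ i, c i * χ i x) ^ 2 = ∑ i, c i ^ 2 * |(χ i x : ℝ)| := by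
  rw [sq_sum_of_pairwise_mul_eq_zero fun i j hij => by rcases hχ hij x with h | h <;> simp [h]]
  simp only [mul_pow, abs_signType_eq_sq]

theorem sum_mul_sq_sum_mul_signType [Fintype X]
    (hχ : Pairwise fun i j => ∀ x, χ i x = 0 ∨ χ j x = 0) (m : X → ℝ) (c : ι → ℝ) :
    ∑ x, m x * (∑ i, c i * χ i x) ^ 2 = ∑ i, c i ^ 2 * ∑ x, m x * |(χ i x : ℝ)| := by
  simp only [sq_sum_mul_signType hχ, Finset.mul_sum]
  rw [Finset.sum_comm]
  simp only [mul_left_comm]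

/-- By Cauchy–Schwarz, since at most one of the `χ i x` and one of the `χ i y` is nonzero. -/
theorem sq_sum_sub_mul_sum_le (hχ : Pairwise fun i j => ∀ x, χ i x = 0 ∨ χ j x = 0) (c : ι → ℝ)
    (s : SignType) (x y : X) :
    (∑ i, c i * (χ i x : ℝ) - s * ∑ i, c i * (χ i y : ℝ)) ^ 2 ≤
      2 * ∑ i, c i ^ 2 * |(χ i x : ℝ) - s * χ i y| := by
  have hcombine : ∑ i, c i * (χ i x : ℝ) - s * ∑ i, c i * (χ i y : ℝ) =
      ∑ i, c i * (χ i x - s * χ i y) := by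
    rw [Finset.mul_sum, ← Finset.sum_sub_distrib]
    exact Finset.sum_congr rfl fun i _ => by ring
  have htwo : ∑ i, |(χ i x : ℝ) - s * χ i y| ≤ 2 :=
    calc ∑ i, |(χ i x : ℝ) - s * χ i y| ≤ ∑ i, (|(χ i x : ℝ)| + |(χ i y : ℝ)|) := by
          refine Finset.sum_le_sum fun i _ => (abs_sub _ _).trans (add_le_add le_rfl ?_)
          rw [abs_mul]
          exact mul_le_of_le_one_left (abs_nonneg _) (by cases s <;> simp)
      _ ≤ 2 := by
          rw [Finset.sum_add_distrib]
          linarith [sum_abs_signType_le_one fun i j hij => hχ hij x,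
            sum_abs_signType_le_one fun i j hij => hχ hij y]
  rw [hcombine, mul_comm 2]
  refine (Finset.sum_sq_le_sum_mul_sum_of_sq_le_mul _ (fun i _ => by positivity)
    (fun i _ => abs_nonneg _) fun i _ => ?_).trans
    (mul_le_mul_of_nonneg_left htwo (Finset.sum_nonneg fun i _ => by positivity))
  rw [mul_assoc, abs_mul_abs_self, mul_pow, sq (_ - _)]

theorem signedEnergy_sum_mul_le [Fintype X] (σ : X → X → SignType)
    (hχ : Pairwise fun i j => ∀ x, χ i x = 0 ∨ χ j x = 0) (c : ι → ℝ) :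
    signedEnergy σ (fun x => ∑ i, c i * χ i x) ≤
      2 * ∑ i, c i ^ 2 * signedVariation σ (fun x => χ i x) := by
  have hcomm : 2 * ∑ i, c i ^ 2 * ∑ x, ∑ y, |(σ x y : ℝ)| * |(χ i x : ℝ) - σ x y * χ i y| =
      ∑ x, ∑ y, |(σ x y : ℝ)| * (2 * ∑ i, c i ^ 2 * |(χ i x : ℝ) - σ x y * χ i y|) := by
    simp only [Finset.mul_sum]
    rw [Finset.sum_comm]
    refine Finset.sum_congr rfl fun x _ => ?_
    rw [Finset.sum_comm]
    exact Finset.sum_congr rfl fun y _ => Finset.sum_congr rfl fun i _ => by ring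
  simp only [signedEnergy, signedVariation, ← mul_div_assoc, ← Finset.sum_div, hcomm]
  gcongr
  exact sq_sum_sub_mul_sum_le hχ c _ _ _

end SignPatterns

section Facets

variable {V : Type*} {K : PreAbstractSimplicialComplex V} {d : ℕ}

theorem exists_forall_mem_iff_ne_of_subset (o : SimplexOrientation K) {τ : Simplex K d}
    {ρ : Simplex K (d + 1)} (h : τ.1 ⊆ ρ.1) :
    ∃ j, ∀ i, (o (d + 1) ρ i : V) ∈ τ.1 ↔ i ≠ j := by
  classical
  obtain ⟨v, hv⟩ := Finset.card_eq_one.1 (show (ρ.1 \ τ.1).card = 1 by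
    rw [Finset.card_sdiff_of_subset h, τ.2.2, ρ.2.2]
    lia)
  have hvρ : v ∈ ρ.1 := (Finset.mem_sdiff.1 (hv ▸ Finset.mem_singleton_self v)).1
  refine ⟨(o (d + 1) ρ).symm ⟨v, hvρ⟩, fun i => ?_⟩
  have hmem : (o (d + 1) ρ i : V) ∈ ρ.1 \ τ.1 ↔ (o (d + 1) ρ i : V) = v := by
    rw [hv, Finset.mem_singleton]
  rw [Finset.mem_sdiff, and_iff_right (o (d + 1) ρ i).2] at hmem
  rw [Ne, Equiv.eq_symm_apply, Subtype.ext_iff, ← hmem, not_not]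

theorem exists_perm_of_forall_mem (o : SimplexOrientation K) {τ : Simplex K d}
    {ρ : Simplex K (d + 1)} {j : Fin (d + 2)}
    (h : ∀ i, (o (d + 1) ρ (j.succAbove i) : V) ∈ τ.1) :
    ∃ π : Equiv.Perm (Fin (d + 1)), ∀ i, (o (d + 1) ρ (j.succAbove i) : V) = o d τ (π i) := by
  have hinj : Function.Injective fun i => (o d τ).symm ⟨_, h i⟩ := fun i i' hi =>
    have hval := Subtype.ext_iff.1 ((o d τ).symm.injective hi)
    Fin.succAbove_right_injective ((o (d + 1) ρ).injective (Subtype.ext hval))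
  exact ⟨Equiv.ofBijective _ (Finite.injective_iff_bijective.1 hinj), fun i => by
    rw [Equiv.ofBijective_apply, Equiv.apply_symm_apply]⟩

theorem abs_sgn_of_subset (o : SimplexOrientation K) {τ : Simplex K d} {ρ : Simplex K (d + 1)}
    (h : τ.1 ⊆ ρ.1) : |sgn o τ ρ| = 1 := by
  classical
  obtain ⟨j, hj⟩ := exists_forall_mem_iff_ne_of_subset o h
  obtain ⟨π, hπ⟩ := exists_perm_of_forall_mem o fun i => (hj _).2 (j.succAbove_ne i)
  have hj_unique : ∀ j' ≠ j, ∀ π' : Equiv.Perm (Fin (d + 1)),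
      ¬ ∀ i, (o (d + 1) ρ (j'.succAbove i) : V) = o d τ (π' i) := fun j' hj' π' hall => by
    obtain ⟨i, hi⟩ := Fin.exists_succAbove_eq hj'.symm
    exact (hj j).1 (hi ▸ hall i ▸ (o d τ (π' i)).2) rfl
  have hπ_unique : ∀ π' ≠ π, ¬ ∀ i, (o (d + 1) ρ (j.succAbove i) : V) = o d τ (π' i) :=
    fun π' hπ' hall => hπ' <| Equiv.ext fun i =>
      (o d τ).injective <| Subtype.ext <| (hall i).symm.trans (hπ i)
  rw [sgn, Finset.sum_eq_single j
      (fun j' _ hj' => Finset.sum_eq_zero fun π' _ => if_neg (hj_unique j' hj' π'))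
      fun h => absurd (Finset.mem_univ j) h,
    Finset.sum_eq_single π (fun π' _ hπ' => if_neg (hπ_unique π' hπ'))
      fun h => absurd (Finset.mem_univ π) h,
    if_pos hπ, abs_mul, abs_neg_one_pow, one_mul, Int.abs_eq_natAbs, Int.units_natAbs, Nat.cast_one]

open Classical in
theorem sgn_sq (o : SimplexOrientation K) (τ : Simplex K d) (ρ : Simplex K (d + 1)) :
    sgn o τ ρ ^ 2 = if τ.1 ⊆ ρ.1 then 1 else 0 := by
  split_ifs with h
  · rw [← sq_abs, abs_sgn_of_subset o h, one_pow]
  · rw [sq_eq_zero_iff]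
    exact not_imp_comm.1 (subset_of_sgn_ne_zero o τ ρ) h

theorem union_eq_of_subset_of_subset [DecidableEq V] {τ τ' : Simplex K d} (hne : τ ≠ τ')
    {ρ : Simplex K (d + 1)} (h : τ.1 ⊆ ρ.1) (h' : τ'.1 ⊆ ρ.1) : τ.1 ∪ τ'.1 = ρ.1 := by
  refine Finset.eq_of_subset_of_card_le (Finset.union_subset h h') ?_
  have hnot : ¬ τ'.1 ⊆ τ.1 := fun hsub =>
    hne (Subtype.ext (Finset.eq_of_subset_of_card_le hsub (by rw [τ.2.2, τ'.2.2])).symm)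
  have hlt := Finset.card_lt_card
    (Finset.ssubset_iff_subset_ne.2 ⟨Finset.subset_union_left, fun heq : τ.1 = τ.1 ∪ τ'.1 =>
      hnot (heq ▸ Finset.subset_union_right)⟩)
  rw [τ.2.2] at hlt
  rw [ρ.2.2]
  exact hlt

theorem pairwise_sgn_mul_sgn_mul_eq_zero (o : SimplexOrientation K) {τ τ' : Simplex K d}
    (hne : τ ≠ τ') :
    Pairwise fun ρ ρ' => sgn o τ ρ * sgn o τ' ρ * (sgn o τ ρ' * sgn o τ' ρ') = 0 := by
  classical
  intro ρ ρ' hρ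
  by_contra h
  have hsub : ∀ {ρ}, sgn o τ ρ * sgn o τ' ρ ≠ 0 → τ.1 ∪ τ'.1 = ρ.1 := fun {ρ} h =>
    union_eq_of_subset_of_subset hne (subset_of_sgn_ne_zero o τ ρ (left_ne_zero_of_mul h))
      (subset_of_sgn_ne_zero o τ' ρ (right_ne_zero_of_mul h))
  exact hρ (Subtype.ext
    ((hsub (left_ne_zero_of_mul h)).symm.trans (hsub (right_ne_zero_of_mul h))))

variable [Finite V]

theorem card_facets [DecidableEq V] (ρ : Simplex K (d + 1)) :
    (Finset.univ.filter fun τ : Simplex K d => τ.1 ⊆ ρ.1).card = d + 2 := by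
  have hcard : (Finset.univ.filter fun τ : Simplex K d => τ.1 ⊆ ρ.1).card =
      (ρ.1.powersetCard (d + 1)).card := by
    refine Finset.card_bij (fun τ _ => τ.1) (fun τ hτ => Finset.mem_powersetCard.2
      ⟨(Finset.mem_filter.1 hτ).2, τ.2.2⟩) (fun τ _ τ' _ h => Subtype.ext h) fun s hs => ?_
    obtain ⟨hsρ, hscard⟩ := Finset.mem_powersetCard.1 hs
    have hs₀ : s.Nonempty := Finset.card_pos.1 (by lia)
    exact ⟨⟨s, (K.isRelLowerSet_faces ρ.2.1).2 hsρ hs₀, hscard⟩,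
      Finset.mem_filter.2 ⟨Finset.mem_univ _, hsρ⟩, rfl⟩
  rw [hcard, Finset.card_powersetCard, ρ.2.2, Nat.choose_succ_self_right]

theorem sum_sgn_sq_facets (o : SimplexOrientation K) (ρ : Simplex K (d + 1)) :
    ∑ τ : Simplex K d, sgn o τ ρ ^ 2 = d + 2 := by
  classical
  simp only [sgn_sq, Finset.sum_boole]
  exact_mod_cast card_facets ρ

theorem sum_sgn_sq_cofaces (o : SimplexOrientation K) (τ : Simplex K d) :
    ∑ ρ : Simplex K (d + 1), sgn o τ ρ ^ 2 = deg τ := by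
  classical
  simp only [sgn_sq, Finset.sum_boole]
  rw [deg, Set.ncard_eq_toFinset_card', Set.toFinset_ofPred]

theorem edgeSign_self (o : SimplexOrientation K) (τ : Simplex K d) : edgeSign o τ τ = deg τ := by
  rw [← sum_sgn_sq_cofaces o τ]
  simp only [edgeSign, sq]

theorem edgeSign_comm (o : SimplexOrientation K) (τ τ' : Simplex K d) :
    edgeSign o τ τ' = edgeSign o τ' τ :=
  Finset.sum_congr rfl fun _ _ => mul_comm _ _

theorem edgeSign_sq (o : SimplexOrientation K) {τ τ' : Simplex K d} (hne : τ ≠ τ') :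
    edgeSign o τ τ' ^ 2 = ∑ ρ, sgn o τ ρ ^ 2 * sgn o τ' ρ ^ 2 := by
  rw [edgeSign, sq_sum_of_pairwise_mul_eq_zero (pairwise_sgn_mul_sgn_mul_eq_zero o hne)]
  simp only [mul_pow]

theorem edgeSign_of_not_adj (o : SimplexOrientation K) {τ τ' : Simplex K d} (hne : τ ≠ τ')
    (h : ¬ (upGraph K d).Adj τ τ') : edgeSign o τ τ' = 0 := by
  refine Finset.sum_eq_zero fun ρ _ => ?_
  by_contra hρ
  exact h ⟨hne, ρ, subset_of_sgn_ne_zero o _ _ (left_ne_zero_of_mul hρ),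
    subset_of_sgn_ne_zero o _ _ (right_ne_zero_of_mul hρ)⟩

theorem edgeSign_of_adj (o : SimplexOrientation K) {τ τ' : Simplex K d}
    (h : (upGraph K d).Adj τ τ') : edgeSign o τ τ' = 1 ∨ edgeSign o τ τ' = -1 := by
  obtain ⟨hne, ρ, hτ, hτ'⟩ := h
  have hρ : |sgn o τ ρ * sgn o τ' ρ| = 1 := by
    rw [abs_mul, abs_sgn_of_subset o hτ, abs_sgn_of_subset o hτ', one_mul]
  have hsingle : edgeSign o τ τ' = sgn o τ ρ * sgn o τ' ρ :=
    Finset.sum_eq_single ρ (fun ρ' _ hρ' => (mul_eq_zero.1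
      (pairwise_sgn_mul_sgn_mul_eq_zero o hne hρ')).resolve_right (by rintro h; simp [h] at hρ))
      fun h => absurd (Finset.mem_univ ρ) h
  rw [hsingle]
  exact eq_or_eq_neg_of_abs_eq hρ

/-- The signed adjacency matrix of `Γ_d`, whose entry at an edge is the sign of the edge. (The
entries `deg τ` of `edgeSign` on the diagonal are discarded.) -/
noncomputable def signedAdj (o : SimplexOrientation K) (τ τ' : Simplex K d) : SignType :=
  if τ = τ' then 0 else SignType.sign (edgeSign o τ τ')

theorem signedAdj_self (o : SimplexOrientation K) (τ : Simplex K d) : signedAdj o τ τ = 0 :=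
  if_pos rfl

theorem signedAdj_comm (o : SimplexOrientation K) (τ τ' : Simplex K d) :
    signedAdj o τ τ' = signedAdj o τ' τ := by
  simp only [signedAdj, edgeSign_comm o τ τ', eq_comm]

theorem coe_signedAdj (o : SimplexOrientation K) {τ τ' : Simplex K d} (hne : τ ≠ τ') :
    (signedAdj o τ τ' : ℝ) = edgeSign o τ τ' := by
  rw [signedAdj, if_neg hne]
  by_cases h : (upGraph K d).Adj τ τ'
  · rcases edgeSign_of_adj o h with hs | hs <;> simp [hs]
  · simp [edgeSign_of_not_adj o hne h]

theorem sum_abs_signedAdj (o : SimplexOrientation K) (τ : Simplex K d) :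
    ∑ τ', |(signedAdj o τ τ' : ℝ)| = (d + 1) * deg τ := by
  have habs : ∀ τ', |(signedAdj o τ τ' : ℝ)| =
      ((∑ ρ, sgn o τ ρ ^ 2 * sgn o τ' ρ ^ 2 - if τ = τ' then (deg τ : ℤ) else 0 : ℤ) : ℝ) := by
    intro τ'
    rw [abs_signType_eq_sq]
    split_ifs with h
    · subst h
      rw [signedAdj_self, ← sum_sgn_sq_cofaces o τ]
      simp [← sq, sgn_sq]
    · rw [coe_signedAdj o h, sub_zero, ← edgeSign_sq o h, Int.cast_pow]
  have hsum : ∑ τ', ∑ ρ, sgn o τ ρ ^ 2 * sgn o τ' ρ ^ 2 = (d + 2) * deg τ := by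
    rw [Finset.sum_comm]
    simp only [← Finset.mul_sum, sum_sgn_sq_facets]
    rw [← Finset.sum_mul, sum_sgn_sq_cofaces, mul_comm]
  simp only [habs]
  rw [← Int.cast_sum, Finset.sum_sub_distrib, hsum, Finset.sum_ite_eq, if_pos (Finset.mem_univ τ)]
  push_cast
  ring

open Matrix

theorem transpose_coboundary_mul_coboundary_apply (o : SimplexOrientation K)
    (τ τ' : Simplex K d) : ((coboundary o d)ᵀ * coboundary o d) τ τ' = edgeSign o τ τ' := by
  simp only [mul_apply, transpose_apply, coboundary, of_apply, edgeSign, Int.cast_sum,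
    Int.cast_mul]

theorem transpose_coboundary_mul_coboundary (o : SimplexOrientation K) (d : ℕ) :
    (coboundary o d)ᵀ * coboundary o d =
      diagonal (fun τ => (deg τ : ℝ)) + of fun τ τ' => (signedAdj o τ τ' : ℝ) := by
  ext τ τ'
  rw [transpose_coboundary_mul_coboundary_apply, Matrix.add_apply, of_apply]
  rcases eq_or_ne τ τ' with rfl | hne
  · rw [diagonal_apply_eq, signedAdj_self, edgeSign_self, SignType.coe_zero, add_zero,
      Int.cast_natCast]
  · rw [diagonal_apply_ne _ hne, coe_signedAdj o hne, zero_add]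

theorem transpose_coboundary_mul_coboundary_of_deg_eq_zero (o : SimplexOrientation K)
    {τ : Simplex K d} (h : (deg τ : ℝ) = 0) (τ' : Simplex K d) :
    ((coboundary o d)ᵀ * coboundary o d) τ τ' = 0 := by
  refine Finset.sum_eq_zero fun ρ _ => mul_eq_zero_of_left (Int.cast_eq_zero.2 ?_) _
  by_contra hρ
  exact (deg_pos_of_sgn_ne_zero o τ ρ hρ).ne' (Nat.cast_eq_zero.1 h)

theorem posSemidef_transpose_coboundary_mul_coboundary (o : SimplexOrientation K) (d : ℕ) :
    ((coboundary o d)ᵀ * coboundary o d).PosSemidef :=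
  posSemidef_conjTranspose_mul_self _

theorem upLaplacian_eq_diagonal_mul (o : SimplexOrientation K) (d : ℕ) :
    upLaplacian o d =
      diagonal (fun τ => (deg τ : ℝ)⁻¹) * ((coboundary o d)ᵀ * coboundary o d) := by
  rw [← Matrix.mul_assoc, upLaplacian]
  congr 1
  ext τ ρ
  rw [diagonal_mul, transpose_apply, coboundaryAdjoint, coboundary, of_apply, of_apply]

theorem signedEnergy_signedAdj (o : SimplexOrientation K) (f : Simplex K d → ℝ) :
    signedEnergy (signedAdj o) f = (d + 2) * ∑ τ, deg τ * f τ ^ 2 -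
      f ⬝ᵥ ((coboundary o d)ᵀ * coboundary o d) *ᵥ f := by
  have hdiag : f ⬝ᵥ diagonal (fun τ => (deg τ : ℝ)) *ᵥ f = ∑ τ, deg τ * f τ ^ 2 :=
    Finset.sum_congr rfl fun τ _ => by rw [mulVec_diagonal]; ring
  have hoff : f ⬝ᵥ (of fun τ τ' => (signedAdj o τ τ' : ℝ)) *ᵥ f =
      ∑ τ, ∑ τ', f τ * (signedAdj o τ τ' * f τ') := by
    simp only [dotProduct, mulVec, of_apply, Finset.mul_sum]
  rw [transpose_coboundary_mul_coboundary, add_mulVec, dotProduct_add, hdiag, hoff,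
    signedEnergy_eq_sub (signedAdj_comm o)]
  simp only [sum_abs_signedAdj, mul_assoc, ← Finset.mul_sum]
  ring

end Facets

section Counting

variable {X : Type*} [Fintype X]

open Classical in
theorem two_mul_ncard_edges_between (G : SimpleGraph X) (p q : X → Prop) :
    2 * ({e : Sym2 X | ∃ x, p x ∧ ∃ y, q y ∧ e = s(x, y) ∧ G.Adj x y}.ncard : ℝ) =
      ∑ x, ∑ y, if G.Adj x y ∧ (p x ∧ q y ∨ q x ∧ p y) then 1 else 0 := by
  let H : SimpleGraph X :=
    { Adj x y := G.Adj x y ∧ (p x ∧ q y ∨ q x ∧ p y)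
      symm := ⟨fun _ _ h => ⟨h.1.symm, h.2.symm.imp And.symm And.symm⟩⟩
      loopless := ⟨fun _ h => G.irrefl h.1⟩ }
  have hedge : {e : Sym2 X | ∃ x, p x ∧ ∃ y, q y ∧ e = s(x, y) ∧ G.Adj x y} = H.edgeSet := by
    ext e
    induction e with
    | _ a b =>
      constructor
      · rintro ⟨x, hx, y, hy, he, hxy⟩
        rw [he]
        exact ⟨hxy, Or.inl ⟨hx, hy⟩⟩
      · rintro ⟨hab, ⟨ha, hb⟩ | ⟨ha, hb⟩⟩
        · exact ⟨a, ha, b, hb, rfl, hab⟩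
        · exact ⟨b, hb, a, ha, Sym2.eq_swap, hab.symm⟩
  have hdegree : ∀ x, H.degree x =
      ∑ y, if G.Adj x y ∧ (p x ∧ q y ∨ q x ∧ p y) then 1 else 0 := fun x => by
    rw [Finset.sum_boole, Nat.cast_id, ← H.card_neighborFinset_eq_degree,
      H.neighborFinset_eq_filter]
  rw [hedge, Set.ncard_eq_toFinset_card', ← SimpleGraph.edgeFinset]
  exact_mod_cast H.sum_degrees_eq_twice_card_edges ▸ Finset.sum_congr rfl fun x _ => hdegree x

end Counting

section PairSign

variable {X : Type*} [DecidableEq X]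

/-- The function `1_A - 1_{A'}` of two disjoint sets `A` and `A'`. -/
def pairSign (A A' : Finset X) (x : X) : SignType :=
  if x ∈ A then 1 else if x ∈ A' then -1 else 0

theorem abs_pairSign (A A' : Finset X) (x : X) :
    |(pairSign A A' x : ℝ)| = if x ∈ A ∪ A' then 1 else 0 := by
  rw [pairSign]
  by_cases hA : x ∈ A <;> by_cases hA' : x ∈ A' <;> simp [hA, hA']

theorem pairSign_eq_zero {A A' : Finset X} {x : X} (hA : x ∉ A) (hA' : x ∉ A') :
    pairSign A A' x = 0 := by
  rw [pairSign, if_neg hA, if_neg hA']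

end PairSign

section Pairs

variable {V : Type*} [Finite V] {K : PreAbstractSimplicialComplex V} {d : ℕ}

/-- The subgraph of `Γ_d` that consists of the edges of sign `c`. -/
def signedUpGraph (o : SimplexOrientation K) (d : ℕ) (c : ℤ) : SimpleGraph (Simplex K d) where
  Adj τ τ' := (upGraph K d).Adj τ τ' ∧ edgeSign o τ τ' = c
  symm := ⟨fun τ τ' h => ⟨h.1.symm, edgeSign_comm o τ τ' ▸ h.2⟩⟩
  loopless := ⟨fun _ h => (upGraph K d).irrefl h.1⟩

open Classical in
theorem two_mul_signedEdges (o : SimplexOrientation K) (c : ℤ) (A B : Finset (Simplex K d)) :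
    2 * (signedEdges o c A B : ℝ) = ∑ τ, ∑ τ',
      if (signedUpGraph o d c).Adj τ τ' ∧ (τ ∈ A ∧ τ' ∈ B ∨ τ ∈ B ∧ τ' ∈ A) then 1 else 0 := by
  rw [signedEdges]
  convert two_mul_ncard_edges_between (signedUpGraph o d c) (· ∈ A) (· ∈ B)
  exact Iff.rfl

open Classical in
theorem two_mul_boundarySize (A : Finset (Simplex K d)) :
    2 * (boundarySize A : ℝ) = ∑ τ, ∑ τ',
      if (upGraph K d).Adj τ τ' ∧ (τ ∈ A ∧ τ' ∉ A ∨ τ ∉ A ∧ τ' ∈ A) then 1 else 0 := by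
  rw [boundarySize]
  convert two_mul_ncard_edges_between (upGraph K d) (· ∈ A) (· ∉ A)

theorem sum_deg_mul_abs_pairSign (A A' : Finset (Simplex K d)) :
    ∑ τ, (deg τ : ℝ) * |(pairSign A A' τ : ℝ)| = vol (A ∪ A') := by
  simp only [abs_pairSign, vol, mul_ite, mul_one, mul_zero, Finset.sum_ite_mem, Finset.univ_inter,
    Nat.cast_sum]

open Classical in
theorem abs_signedAdj_mul_abs_sub_pairSign (o : SimplexOrientation K)
    {A A' : Finset (Simplex K d)} (hA : Disjoint A A') (τ τ' : Simplex K d) :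
    |(signedAdj o τ τ' : ℝ)| * |(pairSign A A' τ : ℝ) - signedAdj o τ τ' * pairSign A A' τ'| =
      2 * ((if (signedUpGraph o d (-1)).Adj τ τ' ∧ (τ ∈ A ∧ τ' ∈ A) then 1 else 0) +
        (if (signedUpGraph o d (-1)).Adj τ τ' ∧ (τ ∈ A' ∧ τ' ∈ A') then 1 else 0) +
        (if (signedUpGraph o d 1).Adj τ τ' ∧ (τ ∈ A ∧ τ' ∈ A' ∨ τ ∈ A' ∧ τ' ∈ A) then 1 else 0)) +
      if (upGraph K d).Adj τ τ' ∧ (τ ∈ A ∪ A' ∧ τ' ∉ A ∪ A' ∨ τ ∉ A ∪ A' ∧ τ' ∈ A ∪ A')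
        then 1 else 0 := by
  by_cases hadj : (upGraph K d).Adj τ τ'
  · have hdisj : ∀ {x}, x ∈ A → x ∉ A' := fun h => Finset.disjoint_left.1 hA h
    have hcases : ∀ x, x ∈ A ∧ x ∉ A' ∨ x ∉ A ∧ x ∈ A' ∨ x ∉ A ∧ x ∉ A' := fun x => by
      have := @hdisj x
      tauto
    rw [coe_signedAdj o hadj.ne]
    rcases edgeSign_of_adj o hadj with hs | hs <;>
      rcases hcases τ with ⟨h₁, h₂⟩ | ⟨h₁, h₂⟩ | ⟨h₁, h₂⟩ <;>
      rcases hcases τ' with ⟨h₃, h₄⟩ | ⟨h₃, h₄⟩ | ⟨h₃, h₄⟩ <;>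
      norm_num [signedUpGraph, pairSign, hs, hadj, h₁, h₂, h₃, h₄]
  · rw [show (signedAdj o τ τ' : ℝ) = 0 from ?_]
    · simp [signedUpGraph, hadj]
    · rcases eq_or_ne τ τ' with rfl | hne
      · rw [signedAdj_self, SignType.coe_zero]
      · rw [coe_signedAdj o hne, edgeSign_of_not_adj o hne hadj, Int.cast_zero]

theorem signedVariation_pairSign (o : SimplexOrientation K) {A A' : Finset (Simplex K d)}
    (hA : Disjoint A A') :
    signedVariation (signedAdj o) (fun τ => pairSign A A' τ) =
      2 * ((signedEdges o (-1) A A : ℝ) + signedEdges o (-1) A' A' + signedEdges o 1 A A')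
        + boundarySize (A ∪ A') := by
  classical
  have hself (B : Finset (Simplex K d)) : 2 * (signedEdges o (-1) B B : ℝ) = ∑ τ, ∑ τ',
      if (signedUpGraph o d (-1)).Adj τ τ' ∧ (τ ∈ B ∧ τ' ∈ B) then 1 else 0 := by
    simp only [two_mul_signedEdges, or_self]
  simp only [signedVariation, abs_signedAdj_mul_abs_sub_pairSign o hA, Finset.sum_add_distrib,
    ← Finset.mul_sum]
  rw [← hself, ← hself, ← two_mul_signedEdges, ← two_mul_boundarySize]
  ring

theorem beta_eq (o : SimplexOrientation K) {A A' : Finset (Simplex K d)} (hA : Disjoint A A') :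
    beta o A A' =
      signedVariation (signedAdj o) (fun τ => pairSign A A' τ) / vol (A ∪ A') := by
  rw [beta, signedVariation_pairSign o hA]

theorem beta_nonneg (o : SimplexOrientation K) (A A' : Finset (Simplex K d)) :
    0 ≤ beta o A A' := by
  rw [beta]
  positivity

end Pairs

section Admissible

variable {V : Type*} {K : PreAbstractSimplicialComplex V} {d k : ℕ}

theorem isAdmissible_pairs {A A' : Fin k → Finset (Simplex K d)}
    (hdisj : ∀ i, Disjoint (A i) (A' i))
    (hpair : Pairwise fun i j => Disjoint (A i ∪ A' i) (A j ∪ A' j))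
    (hvol : ∀ i, 0 < vol (A i ∪ A' i)) :
    IsAdmissible fun p : Fin k × Fin 2 => ![A p.1, A' p.1] p.2 := by
  have hsub : ∀ i a, ![A i, A' i] a ⊆ A i ∪ A' i := fun i =>
    Fin.forall_fin_two.2 ⟨Finset.subset_union_left, Finset.subset_union_right⟩
  refine ⟨?_, hvol⟩
  rintro ⟨i, a⟩ ⟨j, b⟩ hne
  rcases eq_or_ne i j with rfl | hij
  · fin_cases a <;> fin_cases b
    · exact absurd rfl hne
    · exact hdisj i
    · exact (hdisj i).symm
    · exact absurd rfl hne
  · exact (hpair hij).mono (hsub i a) (hsub j b)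

theorem IsAdmissible.pairwise_pairSign_eq_zero {A : Fin k × Fin 2 → Finset (Simplex K d)}
    (hA : IsAdmissible A) :
    Pairwise fun i j => ∀ τ, pairSign (A (i, 0)) (A (i, 1)) τ = 0 ∨
      pairSign (A (j, 0)) (A (j, 1)) τ = 0 := by
  intro i j hij τ
  by_cases h : ∃ a, τ ∈ A (i, a)
  · obtain ⟨a, ha⟩ := h
    have hj : ∀ b, τ ∉ A (j, b) := fun b =>
      Finset.disjoint_left.1 (hA.1 fun h => hij (congrArg Prod.fst h)) ha
    exact Or.inr (pairSign_eq_zero (hj 0) (hj 1))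
  · rw [not_exists] at h
    exact Or.inl (pairSign_eq_zero (h 0) (h 1))

end Admissible

section LowerBound

theorem levelSign_eq_pairSign {X : Type*} [Fintype X] [DecidableEq X] (f : X → ℝ) (t : ℝ)
    (x : X) :
    levelSign t (f x) = pairSign {x | t < f x ^ 2 ∧ 0 < f x} {x | t < f x ^ 2 ∧ f x < 0} x := by
  rw [levelSign, pairSign]
  rcases lt_trichotomy (f x) 0 with h | h | h <;> by_cases ht : t < f x ^ 2 <;>
    simp [h, ht, h.not_gt]

variable {V : Type*} [Finite V] {K : PreAbstractSimplicialComplex V} {d k : ℕ}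

theorem exists_pair_forall_beta_mul_vol_le (o : SimplexOrientation K) {S : Finset (Simplex K d)}
    (hS : 0 < vol S) :
    ∃ A A' : Finset (Simplex K d), Disjoint A A' ∧ A ∪ A' ⊆ S ∧ 0 < vol (A ∪ A') ∧
      ∀ B B' : Finset (Simplex K d), Disjoint B B' → B ∪ B' ⊆ S →
        beta o A A' * vol (B ∪ B') ≤ signedVariation (signedAdj o) fun τ => pairSign B B' τ := by
  obtain ⟨⟨A, A'⟩, ⟨hdisj, hsub, hvol⟩, hmin⟩ := Set.exists_min_image
    {A : Finset (Simplex K d) × Finset (Simplex K d) |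
      Disjoint A.1 A.2 ∧ A.1 ∪ A.2 ⊆ S ∧ 0 < vol (A.1 ∪ A.2)}
    (fun A => beta o A.1 A.2) (Set.toFinite _)
    ⟨(S, ∅), Finset.disjoint_empty_right _, (Finset.union_empty S).subset,
      by rwa [Finset.union_empty]⟩
  refine ⟨A, A', hdisj, hsub, hvol, fun B B' hB hBS => ?_⟩
  rcases (vol (B ∪ B')).eq_zero_or_pos with h | h
  · rw [h, Nat.cast_zero, mul_zero, signedVariation]
    positivity
  · rw [← le_div_iff₀ (Nat.cast_pos.2 h), ← beta_eq o hB]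
    exact hmin (B, B') ⟨hB, hBS, h⟩

theorem vol_support_pos {f : Simplex K d → ℝ} (hf : 0 < ∑ τ, (deg τ : ℝ) * f τ ^ 2) :
    0 < vol {τ | f τ ≠ 0} := by
  refine Nat.pos_of_ne_zero fun h => hf.ne' (Finset.sum_eq_zero fun τ _ => ?_)
  rcases eq_or_ne (f τ) 0 with hτ | hτ
  · rw [hτ, sq, mul_zero, mul_zero]
  · rw [Finset.sum_eq_zero_iff.1 h τ (Finset.mem_filter.2 ⟨Finset.mem_univ τ, hτ⟩),
      Nat.cast_zero, zero_mul]

theorem exists_pair_beta_sq_le (o : SimplexOrientation K) {f : Simplex K d → ℝ}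
    (hf : 0 < ∑ τ, (deg τ : ℝ) * f τ ^ 2) :
    ∃ A A' : Finset (Simplex K d), Disjoint A A' ∧ (∀ τ ∈ A ∪ A', f τ ≠ 0) ∧ 0 < vol (A ∪ A') ∧
      beta o A A' ^ 2 * ∑ τ, (deg τ : ℝ) * f τ ^ 2 ≤
        2 * (d + 1) * signedEnergy (signedAdj o) f := by
  obtain ⟨A, A', hdisj, hsub, hvol, hmin⟩ :=
    exists_pair_forall_beta_mul_vol_le o (vol_support_pos hf)
  refine ⟨A, A', hdisj, fun τ hτ => (Finset.mem_filter.1 (hsub hτ)).2, hvol,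
    sq_mul_sum_le_signedEnergy (signedAdj_comm o) (fun τ => Nat.cast_nonneg (deg τ))
      (by positivity) (fun τ => (sum_abs_signedAdj o τ).le) f (beta_nonneg o A A') fun t _ => ?_⟩
  simp only [levelSign_eq_pairSign, sum_deg_mul_abs_pairSign]
  refine hmin _ _ (Finset.disjoint_filter.2 fun τ _ h h' => h.2.not_gt h'.2) fun τ hτ => ?_
  rcases Finset.mem_union.1 hτ with h | h
  · exact Finset.mem_filter.2 ⟨Finset.mem_univ τ, (Finset.mem_filter.1 h).2.2.ne'⟩
  · exact Finset.mem_filter.2 ⟨Finset.mem_univ τ, (Finset.mem_filter.1 h).2.2.ne⟩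

theorem cheeger_nonneg (o : SimplexOrientation K) (d k : ℕ) : 0 ≤ cheeger o d k :=
  Real.iInf_nonneg fun _ => Real.iSup_nonneg fun _ => beta_nonneg o _ _

theorem cheeger_le (o : SimplexOrientation K) {A : Fin k × Fin 2 → Finset (Simplex K d)}
    (hA : IsAdmissible A) {b : ℝ} (hb : 0 ≤ b) (hbeta : ∀ i, beta o (A (i, 0)) (A (i, 1)) ≤ b) :
    cheeger o d k ≤ b :=
  (ciInf_le (Set.finite_range fun A : {A : Fin k × Fin 2 → Finset (Simplex K d) //
    IsAdmissible A} => ⨆ i, beta o (A.1 (i, 0)) (A.1 (i, 1))).bddBelow ⟨A, hA⟩).trans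
    (Real.iSup_le hbeta hb)

theorem cheeger_sq_le (o : SimplexOrientation K) {ψ : Fin k → Simplex K d → ℝ}
    (hψ : Pairwise fun i j => ∀ τ, ψ i τ = 0 ∨ ψ j τ = 0)
    (hpos : ∀ i, 0 < ∑ τ, (deg τ : ℝ) * ψ i τ ^ 2) {M : ℝ} (hM₀ : 0 ≤ M)
    (hM : ∀ i, signedEnergy (signedAdj o) (ψ i) ≤ M * ∑ τ, (deg τ : ℝ) * ψ i τ ^ 2) :
    cheeger o d k ^ 2 ≤ 2 * (d + 1) * M := by
  choose A A' hdisj hsupp hvol hbeta using fun i => exists_pair_beta_sq_le o (hpos i)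
  have hadm := isAdmissible_pairs hdisj (fun i j hij => Finset.disjoint_left.2 fun τ hi hj =>
    (hψ hij τ).elim (hsupp i τ hi) (hsupp j τ hj)) hvol
  refine (Real.le_sqrt (cheeger_nonneg o d k) (by positivity)).1
    (cheeger_le o hadm (Real.sqrt_nonneg _) fun i => Real.le_sqrt_of_sq_le ?_)
  refine le_of_mul_le_mul_right ((hbeta i).trans ?_) (hpos i)
  rw [mul_assoc _ M]
  exact mul_le_mul_of_nonneg_left (hM i) (by positivity)

end LowerBound

section UpperBound

variable {V : Type*} {K : PreAbstractSimplicialComplex V} {d k : ℕ} [Finite V]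

theorem IsAdmissible.sum_deg_mul_sq {A : Fin k × Fin 2 → Finset (Simplex K d)}
    (hA : IsAdmissible A) (c : Fin k → ℝ) :
    ∑ τ, (deg τ : ℝ) * (∑ i, c i * pairSign (A (i, 0)) (A (i, 1)) τ) ^ 2 =
      ∑ i, c i ^ 2 * vol (A (i, 0) ∪ A (i, 1)) := by
  simp only [sum_mul_sq_sum_mul_signType hA.pairwise_pairSign_eq_zero, sum_deg_mul_abs_pairSign]

theorem IsAdmissible.signedEnergy_le (o : SimplexOrientation K)
    {A : Fin k × Fin 2 → Finset (Simplex K d)} (hA : IsAdmissible A) (c : Fin k → ℝ) :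
    signedEnergy (signedAdj o) (fun τ => ∑ i, c i * pairSign (A (i, 0)) (A (i, 1)) τ) ≤
      2 * (⨆ i, beta o (A (i, 0)) (A (i, 1))) *
        ∑ τ, (deg τ : ℝ) * (∑ i, c i * pairSign (A (i, 0)) (A (i, 1)) τ) ^ 2 := by
  have hvariation : ∀ i, signedVariation (signedAdj o) (fun τ => pairSign (A (i, 0)) (A (i, 1)) τ) ≤
      (⨆ i, beta o (A (i, 0)) (A (i, 1))) * vol (A (i, 0) ∪ A (i, 1)) := fun i => by
    have hdisj : Disjoint (A (i, 0)) (A (i, 1)) := hA.1 (by simp)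
    rw [← div_le_iff₀ (Nat.cast_pos.2 (hA.2 i)), ← beta_eq o hdisj]
    exact le_ciSup (f := fun i => beta o (A (i, 0)) (A (i, 1))) (Set.finite_range _).bddAbove i
  refine (signedEnergy_sum_mul_le _ hA.pairwise_pairSign_eq_zero c).trans ?_
  rw [hA.sum_deg_mul_sq, mul_assoc]
  refine mul_le_mul_of_nonneg_left ?_ zero_le_two
  rw [Finset.mul_sum]
  refine Finset.sum_le_sum fun i _ => ?_
  rw [mul_left_comm]
  exact mul_le_mul_of_nonneg_left (hvariation i) (sq_nonneg _)

theorem exists_isAdmissible (hk : k ≤ {τ : Simplex K d | 0 < deg τ}.ncard) :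
    ∃ A : Fin k × Fin 2 → Finset (Simplex K d), IsAdmissible A := by
  have hcard : Fintype.card (Fin k) ≤ Nat.card {τ : Simplex K d // 0 < deg τ} := by
    rwa [Fintype.card_fin]
  rw [Nat.card_eq_fintype_card] at hcard
  obtain ⟨p⟩ := Function.Embedding.nonempty_of_card_le hcard
  refine ⟨_, isAdmissible_pairs (A := fun i => {(p i : Simplex K d)}) (A' := fun _ => ∅)
    (fun _ => Finset.disjoint_empty_right _) (fun i j hij => ?_) fun i => ?_⟩
  · beta_reduce
    rw [Finset.union_empty, Finset.union_empty, Finset.disjoint_singleton]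
    exact fun h => hij (p.injective (Subtype.ext h))
  · rw [Finset.union_empty, vol, Finset.sum_singleton]
    exact (p i).2

end UpperBound

section Eigenvalue

variable {V : Type*} [Finite V] {K : PreAbstractSimplicialComplex V} {d k : ℕ}

theorem ncard_deg_pos_le : {τ : Simplex K d | 0 < deg τ}.ncard ≤ Fintype.card (Simplex K d) := by
  rw [← Nat.card_eq_fintype_card]
  exact Set.ncard_le_card _

theorem eigenvalue_eq (o : SimplexOrientation K) (hk : 1 ≤ k)
    (hkcard : k ≤ Fintype.card (Simplex K d)) :
    eigenvalue o d (Nat.card (Simplex K d) + 1 - k) =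
      (isHermitian_normalizedMatrix (fun τ : Simplex K d => (deg τ : ℝ))
        (posSemidef_transpose_coboundary_mul_coboundary o d).isHermitian).eigenvalues₀
          ⟨k - 1, by lia⟩ := by
  rw [← getD_sort_roots_charpoly, charpoly_normalizedMatrix fun τ => Nat.cast_nonneg (deg τ),
    ← upLaplacian_eq_diagonal_mul, eigenvalue, Nat.card_eq_fintype_card]
  congr 1
  dsimp only
  lia

theorem exists_orthonormal_signedEnergy_le (o : SimplexOrientation K) (hk : 1 ≤ k)
    (hkn : k ≤ {τ : Simplex K d | 0 < deg τ}.ncard) :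
    ∃ f : Fin k → Simplex K d → ℝ,
      (∀ i j, ∑ τ, (deg τ : ℝ) * (f i τ * f j τ) = if i = j then 1 else 0) ∧
      ∀ i, signedEnergy (signedAdj o) (f i) ≤
        d + 2 - eigenvalue o d (Nat.card (Simplex K d) + 1 - k) := by
  have hkcard := hkn.trans ncard_deg_pos_le
  obtain ⟨f, horth, hf⟩ := exists_orthonormal_eigenvalues₀_le (i := ⟨k - 1, by lia⟩)
    (fun τ => Nat.cast_nonneg (deg τ)) (posSemidef_transpose_coboundary_mul_coboundary o d)
    (by simpa only [Nat.cast_pos] using hkn) (by dsimp only; lia)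
  refine ⟨f, horth, fun i => ?_⟩
  have hnorm : ∑ τ, (deg τ : ℝ) * f i τ ^ 2 = 1 := by
    simpa only [sq, if_true] using horth i i
  rw [signedEnergy_signedAdj, hnorm, mul_one, eigenvalue_eq o hk hkcard]
  exact sub_le_sub_left (hf i) _

theorem IsAdmissible.sub_two_mul_le_eigenvalue (o : SimplexOrientation K) (hk : 1 ≤ k)
    (hkn : k ≤ {τ : Simplex K d | 0 < deg τ}.ncard)
    {A : Fin k × Fin 2 → Finset (Simplex K d)} (hA : IsAdmissible A) :
    d + 2 - 2 * (⨆ i, beta o (A (i, 0)) (A (i, 1))) ≤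
      eigenvalue o d (Nat.card (Simplex K d) + 1 - k) := by
  let G : (Fin k → ℝ) →ₗ[ℝ] Simplex K d → ℝ :=
    Fintype.linearCombination ℝ fun i τ => (pairSign (A (i, 0)) (A (i, 1)) τ : ℝ)
  have hG : ∀ c τ, G c τ = ∑ i, c i * pairSign (A (i, 0)) (A (i, 1)) τ := fun c τ => by
    simp only [G, Fintype.linearCombination_apply, Finset.sum_apply, Pi.smul_apply, smul_eq_mul]
  rw [eigenvalue_eq o hk (hkn.trans ncard_deg_pos_le)]
  refine le_eigenvalues₀_normalizedMatrix (G := G) (fun τ => Nat.cast_nonneg (deg τ))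
    (posSemidef_transpose_coboundary_mul_coboundary o d).isHermitian
    (fun τ τ' h => transpose_coboundary_mul_coboundary_of_deg_eq_zero o h τ') (fun c hc => ?_)
    (by rw [Module.finrank_fin_fun]; dsimp only; lia) fun c => ?_
  · obtain ⟨i, hi⟩ := Function.ne_iff.1 hc
    simp only [hG, hA.sum_deg_mul_sq]
    exact Finset.sum_pos' (fun j _ => by positivity)
      ⟨i, Finset.mem_univ i, mul_pos (sq_pos_of_ne_zero hi) (Nat.cast_pos.2 (hA.2 i))⟩
  · have henergy := hA.signedEnergy_le o c
    simp only [← hG] at henergy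
    rw [signedEnergy_signedAdj] at henergy
    linarith

theorem sub_eigenvalue_le_two_mul_cheeger (o : SimplexOrientation K) (hk : 1 ≤ k)
    (hkn : k ≤ {τ : Simplex K d | 0 < deg τ}.ncard) :
    d + 2 - eigenvalue o d (Nat.card (Simplex K d) + 1 - k) ≤ 2 * cheeger o d k := by
  have : Nonempty {A : Fin k × Fin 2 → Finset (Simplex K d) // IsAdmissible A} :=
    nonempty_subtype.2 (exists_isAdmissible hkn)
  rw [← div_le_iff₀' two_pos]
  refine le_ciInf fun A => ?_
  have := A.2.sub_two_mul_le_eigenvalue o hk hkn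
  linarith

theorem cheeger_one_sq_le (o : SimplexOrientation K)
    (hpos : 1 ≤ {τ : Simplex K d | 0 < deg τ}.ncard) :
    cheeger o d 1 ^ 2 ≤ 2 * (d + 1) * (d + 2 - eigenvalue o d (Nat.card (Simplex K d))) := by
  obtain ⟨f, horth, henergy⟩ := exists_orthonormal_signedEnergy_le o le_rfl hpos
  rw [Nat.add_sub_cancel] at henergy
  have hnorm : ∀ i, ∑ τ, (deg τ : ℝ) * f i τ ^ 2 = 1 := fun i => by
    simpa only [sq, if_true] using horth i i
  exact cheeger_sq_le o (fun i j hij => absurd (Subsingleton.elim i j) hij)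
    (fun i => (hnorm i).symm ▸ one_pos) ((signedEnergy_nonneg _ _).trans (henergy 0))
    fun i => by rw [hnorm, mul_one]; exact henergy i

theorem cheeger_sq_le_pow_six (o : SimplexOrientation K) (hk : 1 ≤ k)
    (hkn : k ≤ {τ : Simplex K d | 0 < deg τ}.ncard) :
    cheeger o d k ^ 2 ≤ 2 * (d + 1) *
      (9216 * k ^ 6 * (d + 2 - eigenvalue o d (Nat.card (Simplex K d) + 1 - k))) := by
  obtain ⟨f, horth, henergy⟩ := exists_orthonormal_signedEnergy_le o hk hkn
  obtain ⟨ψ, hdisj, hψ⟩ := exists_disjoint_support_signedEnergy_le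
    (fun τ => Nat.cast_nonneg (deg τ)) hk horth henergy
  have hgap := (signedEnergy_nonneg _ _).trans (henergy ⟨0, hk⟩)
  exact cheeger_sq_le o hdisj (fun i => (hψ i).1) (by positivity) fun i => (hψ i).2

end Eigenvalue

end SimplicialCheeger

theorem mainTheorem2 :
    (∀ (V : Type*) [Finite V] (K : PreAbstractSimplicialComplex V)
        (o : SimplicialCheeger.SimplexOrientation K) (d : ℕ),
        (∃ τ : SimplicialCheeger.Simplex K d, 0 < SimplicialCheeger.deg τ) →
        SimplicialCheeger.cheeger o d 1 ^ 2 / (2 * ((d : ℝ) + 1)) ≤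
            (d : ℝ) + 2 -
              SimplicialCheeger.eigenvalue o d (Nat.card (SimplicialCheeger.Simplex K d)) ∧
          (d : ℝ) + 2 -
              SimplicialCheeger.eigenvalue o d (Nat.card (SimplicialCheeger.Simplex K d)) ≤
            2 * SimplicialCheeger.cheeger o d 1) ∧
    ∃ C : ℝ, 0 < C ∧
      ∀ (V : Type*) [Finite V] (K : PreAbstractSimplicialComplex V)
        (o : SimplicialCheeger.SimplexOrientation K) (d k : ℕ),
        1 ≤ k →
        k ≤ {τ : SimplicialCheeger.Simplex K d | 0 < SimplicialCheeger.deg τ}.ncard →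
        SimplicialCheeger.cheeger o d k ^ 2 / (C * (k : ℝ) ^ 6 * ((d : ℝ) + 1)) ≤
            (d : ℝ) + 2 -
              SimplicialCheeger.eigenvalue o d
                (Nat.card (SimplicialCheeger.Simplex K d) + 1 - k) ∧
          (d : ℝ) + 2 -
              SimplicialCheeger.eigenvalue o d
                (Nat.card (SimplicialCheeger.Simplex K d) + 1 - k) ≤
            2 * SimplicialCheeger.cheeger o d k := by
  refine ⟨fun V _ K o d hpos => ?_, 18432, by norm_num, fun V _ K o d k hk hkn => ?_⟩
  · have hncard : 1 ≤ {τ : SimplicialCheeger.Simplex K d | 0 < SimplicialCheeger.deg τ}.ncard :=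
      (Set.ncard_pos (Set.toFinite _)).2 hpos
    refine ⟨?_, SimplicialCheeger.sub_eigenvalue_le_two_mul_cheeger o le_rfl hncard⟩
    rw [div_le_iff₀' (by positivity)]
    exact SimplicialCheeger.cheeger_one_sq_le o hncard
  · refine ⟨?_, SimplicialCheeger.sub_eigenvalue_le_two_mul_cheeger o hk hkn⟩
    rw [div_le_iff₀' (by positivity)]
    linarith [SimplicialCheeger.cheeger_sq_le_pow_six o hk hkn]
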